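/- **Setting.** Let $\hat\Sigma$ be a simplicial complex on a set $X$: a family of finite subsets of $X$ (simplices), closed under taking subsets and containing $\varnothing$, and let $m:\hat\Sigma\to(0,\infty)$. Write $\tau\prec\sigma$ (or $\sigma\succ\tau$) if $\tau\subseteq\sigma$ and $|\sigma\setminus\tau|=1$. Put $\Sigma=\hat\Sigma$ if the sum of $m$ over all vertices is finite and $\Sigma=\hat\Sigma\setminus\{\varnothing\}$ otherwise, and assume that $(\Sigma,m)$ is a weighted simplicial complex, i.e. $\sum_{\sigma\succ\tau}m(\sigma)<\infty$ for all $\tau\in\Sigma$. Let $C(\Sigma)$ be the space of complex functions on $\Sigma$, $\ell^2=\{\omega\in C(\Sigma):\sum_{\Sigma}m|\omega|^2<\infty\}$, and let $\delta:C(\Sigma)\to C(\Sigma)$, $\delta\omega(\sigma)=\sum_{\tau\prec\sigma}\theta(\tau,\sigma)\omega(\tau)$, be a coboundary operator, where $\theta(\tau,\sigma)\in\{\pm1\}$ for $\tau\prec\sigma$ and $\delta\delta=0$. The boundary operator is $$\partial\omega(\rho)=\frac1{m(\rho)}\sum_{\tau\succ\rho}m(\tau)\theta(\rho,\tau)\omega(\tau),\qquad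 D(\partial)=\Big\{\omega\in C(\Sigma):\sum_{\tau\succ\rho}m(\tau)|\omega(\tau)|<\infty\text{ for all }\rho\in\Sigma\Big\},$$ and $\partial_N$ is the restriction of $\partial$ to $\{\omega\in\ell^2:\partial\omega\in\ell^2\}$ (note $\ell^2\subseteq D(\partial)$). For $\rho\in\Sigma$ the link is $\mathrm{lk}(\rho)=\{v:\{v\}\in\Sigma,\ v\rho:=\{v\}\cup\rho\in\Sigma,\ v\rho\succ\rho\}$, with weights $m_\rho(v)=m(v\rho)$ and graph $b_\rho(v,v')=m(vv'\rho)$ for $v\ne v'$ with $vv'\rho:=\{v,v'\}\cup\rho\in\Sigma$, and $b_\rho(v,v')=0$ otherwise. Two vertices are adjacent if $b_\rho(v,v')>0$. A connected component of $b_\rho$ is recurrent if the random walk $(Y_n)$ on it with transition probabilities $b_\rho(x,y)/\sum_z b_\rho(x,z)$ (staying put at a vertex without neighbours) satisfies $\mathbb P(Y_k=y\text{ for some }k>0\mid Y_0=x)=1$ for all its vertices $x,y$; otherwise it is transient. A monopole at $v_0\in\mathrm{lk}(\rho)$ is a function $u:\mathrm{lk}(\rho)\to\mathbb C$ with $\sum_{v,v'}b_\rho(v,v')|u(v)-u(v')|^2<\infty$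 and $\mathcal L_\rho u=1_{v_0}$, where $\mathcal L_\rho u(v)=\frac1{m_\rho(v)}\sum_{v'}b_\rho(v,v')(u(v)-u(v'))$. Let $\pi^\rho u(v\rho)=\theta(\rho,v\rho)u(v)$ for $v\in\mathrm{lk}(\rho)$ and $\pi^\rho u(\tau)=0$ for $\tau\not\succ\rho$. The pair $(\Sigma,m)$ is locally balanced if for every $\rho\in\Sigma$ the quotients $m(vv'\rho)/m(vv'\rho\setminus\{w\})$, over all $v\neq v'$ in $\mathrm{lk}(\rho)$ with $vv'\rho\in\Sigma$ and all $w\in\rho$, are bounded. **Theorem.** Assume that $(\Sigma,m)$ is locally balanced. Then: 1. $\partial\partial_N=0$ if and only if for every $\rho\in\Sigma$ all connected components of $b_\rho$ are recurrent. 2. If $\rho\in\Sigma$ and some connected component of $b_\rho$ is transient, then there are a vertex $v_0$ in this component and a monopole $u$ at $v_0$ on $\mathrm{lk}(\rho)$. 3. For every $\rho\in\Sigma$, every $v_0\in\mathrm{lk}(\rho)$ and every monopole $u$ at $v_0$, the function $\omega=\delta\pi^\rho u$ satisfies $\omega\in\ell^2$, $\partial\omega\in\ell^2$ and $\partial\partial\omega(\rho)\neq0$.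 -/

import Mathlib

open MeasureTheory ProbabilityTheory

noncomputable section

/-! ### Weighted graphs, random walks and recurrence -/

/-- A graph over `V`: a symmetric, locally summable edge weight `b : V × V → [0, ∞)` with vanishing
diagonal. -/
structure WGraph (V : Type*) where
  b : V → V → ℝ
  nonneg : ∀ x y, 0 ≤ b x y
  symm : ∀ x y, b x y = b y x
  diag : ∀ x, b x x = 0
  summable : ∀ x, Summable (b x)

namespace WGraph

variable {V : Type*} (G : WGraph V)

/-- The combinatorial graph: `x` and `y` are neighbours iff `b x y > 0`. -/
def toSimpleGraph : SimpleGraph V where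
  Adj x y := 0 < G.b x y
  symm := ⟨fun x y h => by rwa [G.symm y x]⟩
  loopless := ⟨fun x h => by simp [G.diag x] at h⟩

/-- The restriction of the graph to a set of vertices. -/
def restrict (S : Set V) : WGraph S where
  b x y := G.b x y
  nonneg x y := G.nonneg x y
  symm x y := G.symm x y
  diag x := G.diag x
  summable x := (G.summable x).subtype S

/-- One step of the random walk: from `x` to `y` with probability `b x y / ∑ z, b x z`. At a vertex
without neighbours the walk stays where it is. -/
def step (x : V) : PMF V :=
  open Classical in
  if h : ∑' y, ENNReal.ofReal (G.b x y) = 0 then PMF.pure x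
  else PMF.normalize (fun y => ENNReal.ofReal (G.b x y)) h (G.summable x).tsum_ofReal_ne_top

/-- The transition kernel of the random walk. -/
def stepKernel [MeasurableSpace V] [DiscreteMeasurableSpace V] : Kernel V V where
  toFun x := (G.step x).toMeasure
  measurable' := Measurable.of_discrete

instance [MeasurableSpace V] [DiscreteMeasurableSpace V] : IsMarkovKernel G.stepKernel :=
  ⟨fun x => inferInstanceAs (IsProbabilityMeasure (G.step x).toMeasure)⟩

/-- The law on `ℕ → V` of the random walk `Y 0, Y 1, …` started at `Y 0 = x`. -/
def walkLaw [MeasurableSpace V] [DiscreteMeasurableSpace V] (x : V) : Measure (ℕ → V) :=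
  Kernel.traj (X := fun _ => V)
    (fun n => G.stepKernel.comap (fun h : Finset.Iic n → V => h ⟨n, Finset.mem_Iic.2 le_rfl⟩)
      (measurable_pi_apply _))
    0 (fun _ => x)

/-- The random walk started anywhere almost surely visits (at a positive time) every vertex. To be
used for connected graphs. -/
def Recurrent : Prop :=
  letI : MeasurableSpace V := ⊤
  ∀ x y : V, G.walkLaw x {Y | ∃ k : ℕ, 0 < k ∧ Y k = y} = 1

/-- The connected component `c`, as a graph of its own. -/
def component (c : G.toSimpleGraph.ConnectedComponent) : WGraph c.supp := G.restrict c.supp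

/-- Functions of finite energy. -/
def finiteEnergy : Set (V → ℂ) :=
  {u | Summable fun p : V × V => G.b p.1 p.2 * ‖u p.1 - u p.2‖ ^ 2}

/-- The formal Laplacian of the graph with respect to the vertex weight `μ`. -/
def laplacian (μ : V → ℝ) (u : V → ℂ) (x : V) : ℂ :=
  (1 / (μ x : ℂ)) * ∑' y, (G.b x y : ℂ) * (u x - u y)

/-- `u` is a monopole at `v₀`: it has finite energy and its Laplacian is `1_{v₀}`. -/
def IsMonopole [DecidableEq V] (μ : V → ℝ) (v₀ : V) (u : V → ℂ) : Prop :=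
  u ∈ G.finiteEnergy ∧ G.laplacian μ u = Pi.single v₀ 1

end WGraph

/-! ### Weighted simplicial complexes -/

/-- `τ ≺ σ`: `τ` is a face of `σ`, i.e. `τ ⊆ σ` and `σ` has exactly one element more. -/
def IsFace {X : Type*} (τ σ : Finset X) : Prop := τ ⊆ σ ∧ σ.card = τ.card + 1

/-- A simplicial complex on a set `X`, together with a weight `m` which is positive on all its
simplices (the values of `m` elsewhere are never used). The empty simplex belongs to every
complex. -/
structure PreWeightedComplex (X : Type*) where
  allSimplices : Set (Finset X)
  empty_mem : ∅ ∈ allSimplices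
  down_closed : ∀ σ ∈ allSimplices, ∀ τ ⊆ σ, τ ∈ allSimplices
  m : Finset X → ℝ
  m_pos : ∀ σ ∈ allSimplices, 0 < m σ

namespace PreWeightedComplex

variable {X : Type*} (K : PreWeightedComplex X)

/-- The set `Σ`: all simplices if the total vertex weight is finite, and all nonempty simplices
otherwise. -/
def simplices : Set (Finset X) :=
  {σ | σ ∈ K.allSimplices ∧
    (σ = ∅ → Summable fun x : {x : X // {x} ∈ K.allSimplices} => K.m {x.1})}

/-- The elements of `Σ` as a type; `C(Σ)` is `K.Simplex → ℂ`. -/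
abbrev Simplex : Type _ := {σ : Finset X // σ ∈ K.simplices}

end PreWeightedComplex

/-- A weighted simplicial complex `(Σ, m)`: the weight is locally summable. -/
structure WeightedComplex (X : Type*) extends PreWeightedComplex X where
  locallySummable : ∀ τ : toPreWeightedComplex.Simplex,
    Summable fun σ : {σ : toPreWeightedComplex.Simplex // IsFace τ.1 σ.1} => m σ.1.1

namespace WeightedComplex

variable {X : Type*} (K : WeightedComplex X)

/-- `ω ∈ ℓ²(Σ, m)`. -/
def IsL2 (ω : K.Simplex → ℂ) : Prop := Summable fun σ : K.Simplex => K.m σ.1 * ‖ω σ‖ ^ 2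

/-- The domain `D(∂)` of the boundary operator. -/
def boundaryDomain : Set (K.Simplex → ℂ) :=
  {ω | ∀ ρ : K.Simplex,
    Summable fun τ : {τ : K.Simplex // IsFace ρ.1 τ.1} => K.m τ.1.1 * ‖ω τ.1‖}

/-- A coboundary operator on `Σ`: a linear operator on `C(Σ)` whose matrix entries
`θ τ σ = δ 1_τ (σ)` are `±1` if `τ ≺ σ` and `0` otherwise, which acts through its matrix, and which
satisfies `δ δ = 0`. -/
structure Coboundary [DecidableEq X] where
  δ : (K.Simplex → ℂ) →ₗ[ℂ] (K.Simplex → ℂ)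
  entry : ∀ τ σ : K.Simplex, δ (Pi.single τ 1) σ ∈ ({1, -1, 0} : Set ℂ)
  entry_ne_zero_iff : ∀ τ σ : K.Simplex, δ (Pi.single τ 1) σ ≠ 0 ↔ IsFace τ.1 σ.1
  apply_eq : ∀ (ω : K.Simplex → ℂ) (σ : K.Simplex),
    δ ω σ = ∑ᶠ τ : {τ : K.Simplex // IsFace τ.1 σ.1}, δ (Pi.single τ.1 1) σ * ω τ.1
  comp_self : ∀ ω, δ (δ ω) = 0

namespace Coboundary

variable [DecidableEq X] {K} (d : K.Coboundary)

/-- The incidence numbers `θ(τ, σ)`. -/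
def θ (τ σ : K.Simplex) : ℂ := d.δ (Pi.single τ 1) σ

/-- The action of the boundary operator `∂` (meaningful on `K.boundaryDomain`). -/
def boundary (ω : K.Simplex → ℂ) (ρ : K.Simplex) : ℂ :=
  (1 / (K.m ρ.1 : ℂ)) *
    ∑' τ : {τ : K.Simplex // IsFace ρ.1 τ.1}, (K.m τ.1.1 : ℂ) * d.θ ρ τ.1 * ω τ.1

/-- The domain of the Neumann boundary operator `∂_N`: all `ω ∈ ℓ²` with `∂ω ∈ ℓ²`. -/
def neumannDomain : Set (K.Simplex → ℂ) :=
  {ω | K.IsL2 ω ∧ ω ∈ K.boundaryDomain ∧ K.IsL2 (d.boundary ω)}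

/-- `∂ ∂_N = 0`, on the natural domain of the composition. -/
def NeumannComplexProperty : Prop :=
  ∀ ω ∈ d.neumannDomain, d.boundary ω ∈ K.boundaryDomain → d.boundary (d.boundary ω) = 0

end Coboundary

/-! ### Links -/

section Link

variable [DecidableEq X]

/-- The vertex set of the link of `ρ`. -/
def link (ρ : K.Simplex) : Set X :=
  {v | {v} ∈ K.simplices ∧ insert v ρ.1 ∈ K.simplices ∧ IsFace ρ.1 (insert v ρ.1)}

/-- The vertex weight `m_ρ(v) = m(vρ)` on the link. -/
def linkWeight (ρ : K.Simplex) (v : K.link ρ) : ℝ := K.m (insert v.1 ρ.1)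

open Classical in
/-- The edge weight `b_ρ(v, v') = m(vv'ρ)` on the link, where `m` counts as `0` on sets which are
not simplices. -/
def linkEdge (ρ : K.Simplex) (v v' : K.link ρ) : ℝ :=
  if v ≠ v' ∧ insert v.1 (insert v'.1 ρ.1) ∈ K.simplices then
    K.m (insert v.1 (insert v'.1 ρ.1)) else 0

theorem notMem_of_link {ρ : K.Simplex} (w : K.link ρ) : w.1 ∉ ρ.1 := by
  intro hw
  have h := w.2.2.2.2
  rw [Finset.insert_eq_of_mem hw] at h
  omega

theorem linkEdge_symm (ρ : K.Simplex) (v v' : K.link ρ) :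
    K.linkEdge ρ v v' = K.linkEdge ρ v' v := by
  unfold linkEdge
  have h : insert v.1 (insert v'.1 ρ.1) = insert v'.1 (insert v.1 ρ.1) := Finset.insert_comm _ _ _
  by_cases hv : v ≠ v' ∧ insert v.1 (insert v'.1 ρ.1) ∈ K.simplices
  · rw [if_pos hv, if_pos ⟨hv.1.symm, h ▸ hv.2⟩, h]
  · rw [if_neg hv, if_neg fun hv' => hv ⟨hv'.1.symm, h ▸ hv'.2⟩]

/-- The edges at `v` in the link correspond to cofaces of `vρ`. -/
def linkCoface (ρ : K.Simplex) (v : K.link ρ)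
    (x : {v' : K.link ρ // v ≠ v' ∧ insert v.1 (insert v'.1 ρ.1) ∈ K.simplices}) :
    {σ : K.Simplex // IsFace (insert v.1 ρ.1) σ.1} :=
  ⟨⟨insert v.1 (insert x.1.1 ρ.1), x.2.2⟩, by
    have h : insert v.1 (insert x.1.1 ρ.1) = insert x.1.1 (insert v.1 ρ.1) :=
      Finset.insert_comm _ _ _
    have hn : x.1.1 ∉ insert v.1 ρ.1 := by
      simp only [Finset.mem_insert, not_or]
      exact ⟨fun h => x.2.1 (Subtype.ext h.symm), K.notMem_of_link _⟩
    change IsFace (insert v.1 ρ.1) (insert v.1 (insert x.1.1 ρ.1))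
    rw [h]
    exact ⟨Finset.subset_insert _ _, Finset.card_insert_of_notMem hn⟩⟩

theorem linkCoface_injective (ρ : K.Simplex) (v : K.link ρ) :
    Function.Injective (K.linkCoface ρ v) := by
  intro x y hxy
  have h : insert v.1 (insert x.1.1 ρ.1) = insert v.1 (insert y.1.1 ρ.1) :=
    congrArg (fun z => z.1.1) hxy
  have hx : x.1.1 ∈ insert v.1 (insert y.1.1 ρ.1) := by rw [← h]; simp
  simp only [Finset.mem_insert] at hx
  rcases hx with hx | hx | hx
  · exact absurd (Subtype.ext hx.symm) x.2.1
  · exact Subtype.ext (Subtype.ext hx)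
  · exact absurd hx (K.notMem_of_link _)

theorem linkEdge_summable (ρ : K.Simplex) (v : K.link ρ) : Summable (K.linkEdge ρ v) := by
  have h1 := (K.locallySummable ⟨insert v.1 ρ.1, v.2.2.1⟩).comp_injective
    (K.linkCoface_injective ρ v)
  have h2 : Summable ((K.linkEdge ρ v) ∘ (Subtype.val : {v' : K.link ρ // v ≠ v' ∧
      insert v.1 (insert v'.1 ρ.1) ∈ K.simplices} → K.link ρ)) := by
    refine h1.congr fun x => ?_
    exact (if_pos x.2).symm
  refine (Subtype.val_injective.summable_iff fun x hx => ?_).1 h2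
  refine if_neg fun h => hx ?_
  exact ⟨⟨x, h⟩, rfl⟩

/-- The graph `b_ρ` over the link of `ρ`. -/
def linkGraph (ρ : K.Simplex) : WGraph (K.link ρ) where
  b := K.linkEdge ρ
  nonneg v v' := by
    unfold linkEdge
    split_ifs with h
    · exact (K.m_pos _ h.2.1).le
    · exact le_rfl
  symm := K.linkEdge_symm ρ
  diag v := by simp [linkEdge]
  summable := K.linkEdge_summable ρ

/-- `(Σ, m)` is locally balanced: for every `ρ ∈ Σ`, the quotients `m(vv'ρ) / m(vv'ρ \ w)` with
`v ≠ v'` in the link of `ρ`, `vv'ρ ∈ Σ` and `w ∈ ρ` are bounded. -/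
def LocallyBalanced : Prop :=
  ∀ ρ : K.Simplex, ∃ C : ℝ, ∀ v v' : K.link ρ, v ≠ v' →
    insert v.1 (insert v'.1 ρ.1) ∈ K.simplices → ∀ w ∈ ρ.1,
      K.m (insert v.1 (insert v'.1 ρ.1)) / K.m ((insert v.1 (insert v'.1 ρ.1)).erase w) ≤ C

/-- All connected components of the graph `b_ρ` are recurrent. -/
def LinkRecurrent (ρ : K.Simplex) : Prop :=
  ∀ c : (K.linkGraph ρ).toSimpleGraph.ConnectedComponent, ((K.linkGraph ρ).component c).Recurrent

variable {K} in
open Classical in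
/-- `π^ρ u`: its value at a coface `vρ` of `ρ` is `θ(ρ, vρ) u(v)`, and it vanishes elsewhere. -/
def Coboundary.lift (d : K.Coboundary) (ρ : K.Simplex) (u : K.link ρ → ℂ) (τ : K.Simplex) : ℂ :=
  if h : ∃ v : K.link ρ, insert v.1 ρ.1 = τ.1 then u h.choose * d.θ ρ τ else 0

end Link

end WeightedComplex

end

/-! Fix `ρ`. A cochain `ω` induces on the link of `ρ` the flow `φ(v,w) = θ(ρ,vρ) θ(vρ,vwρ) ω(vwρ)`.
The identity `δδ = 0` makes `φ` antisymmetric (`sign_swap`), its divergence at `v` is `m(vρ) θ(ρ,vρ)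
∂ω(vρ)` (`divergence_flow`), and `ω ∈ ℓ²` gives it finite energy. Hence `m(ρ) ∂∂ω(ρ)` is the total
divergence of a flow of finite energy, and the question is whether such a flow can have a net
source.

On a recurrent component it cannot. The Green functions up to time `N`, normalised at a base vertex
and cut at `1`, converge to `1` pointwise and to `0` in energy, because the expected number of
visits diverges (`exists_isNullSequence`). Pairing the divergence with these functions and summing
by parts shows that the total divergence vanishes (`tsum_divergence_eq_zero`). Summing over the
components gives `∂∂ω(ρ) = 0`.

On a transient component the Green function is finite and of finite energy, and its Laplacian is
concentrated at its pole; scaled and extended by zero it is a monopole (`exists_monopole`).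

For a monopole `u` at `v₀` put `ω = δπu`. Its values on the simplices `vv'ρ` are `±(u(v) - u(v'))`,
so finite energy of `u` means `ω ∈ ℓ²`. On the cofaces `vρ`, `∂ω` is the Laplacian of `u` up to
sign, hence is supported at `v₀ρ`; this makes `∂∂ω(ρ) = m(v₀ρ)/m(ρ) ≠ 0`. The other simplices where
`∂ω` can be nonzero are the `vv'ρ \ w` with `w ∈ ρ`. Each has a single coface in the support of `ω`,
and local balance bounds their contribution by the energy of `u` (`isL2_boundary_δ_lift`). -/

noncomputable section

open scoped ENNReal
open Filter Topology

namespace WGraph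

variable {V : Type*} (G : WGraph V)

/-! ### The transition operator of the random walk -/

/-- The total edge weight at a vertex. -/
def deg (x : V) : ℝ := ∑' y, G.b x y

theorem deg_nonneg (x : V) : 0 ≤ G.deg x := tsum_nonneg (G.nonneg x)

theorem ofReal_deg (x : V) : ENNReal.ofReal (G.deg x) = ∑' y, ENNReal.ofReal (G.b x y) :=
  ENNReal.ofReal_tsum_of_nonneg (G.nonneg x) (G.summable x)

/-- Reversibility of the walk. At a vertex without neighbours both sides vanish, so the convention
of staying put does no harm. -/
theorem ofReal_deg_mul_step (x z : V) :
    ENNReal.ofReal (G.deg x) * G.step x z = ENNReal.ofReal (G.b x z) := by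
  by_cases h : ∑' y, ENNReal.ofReal (G.b x y) = 0
  · rw [ofReal_deg, h, zero_mul, ENNReal.tsum_eq_zero.1 h z]
  · rw [step, dif_neg h, PMF.normalize_apply, ofReal_deg, mul_comm, mul_assoc,
      ENNReal.inv_mul_cancel h (G.summable x).tsum_ofReal_ne_top, mul_one]

theorem step_ne_zero {x z : V} (h : 0 < G.b x z) : G.step x z ≠ 0 := by
  intro h0
  have := G.ofReal_deg_mul_step x z
  rw [h0, mul_zero, eq_comm, ENNReal.ofReal_eq_zero] at this
  linarith

/-- The transition operator of the random walk on nonnegative functions. -/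
def transition (f : V → ℝ≥0∞) (x : V) : ℝ≥0∞ := ∑' z, G.step x z * f z

/-- The transition operator of the random walk killed when it enters `y`. -/
def killed (y : V) (f : V → ℝ≥0∞) : V → ℝ≥0∞ := G.transition (({y}ᶜ : Set V).indicator f)

theorem transition_mono {f g : V → ℝ≥0∞} (h : ∀ x, f x ≤ g x) (x : V) :
    G.transition f x ≤ G.transition g x :=
  ENNReal.tsum_le_tsum fun z => by gcongr; exact h z

theorem transition_add (f g : V → ℝ≥0∞) (x : V) :
    G.transition (fun z => f z + g z) x = G.transition f x + G.transition g x := by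
  simp only [transition, mul_add, ENNReal.tsum_add]

theorem transition_const_mul (c : ℝ≥0∞) (f : V → ℝ≥0∞) (x : V) :
    G.transition (fun z => c * f z) x = c * G.transition f x := by
  simp only [transition, ← ENNReal.tsum_mul_left, mul_left_comm]

theorem transition_const (c : ℝ≥0∞) (x : V) : G.transition (fun _ => c) x = c := by
  simp only [transition, ENNReal.tsum_mul_right, PMF.tsum_coe, one_mul]

theorem transition_tsum (f : ℕ → V → ℝ≥0∞) (x : V) :
    G.transition (fun z => ∑' n, f n z) x = ∑' n, G.transition (f n) x := by
  simp only [transition, ← ENNReal.tsum_mul_left]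
  exact ENNReal.tsum_comm

theorem ofReal_deg_mul_transition (f : V → ℝ≥0∞) (x : V) :
    ENNReal.ofReal (G.deg x) * G.transition f x = ∑' z, ENNReal.ofReal (G.b x z) * f z := by
  simp only [transition, ← ENNReal.tsum_mul_left, ← mul_assoc, ofReal_deg_mul_step]

theorem lintegral_step [MeasurableSpace V] [DiscreteMeasurableSpace V] (f : V → ℝ≥0∞) (x : V) :
    ∫⁻ z, f z ∂(G.step x).toMeasure = G.transition f x := by
  have h : (G.step x).toMeasure = Measure.sum fun z => G.step x z • Measure.dirac z := by
    ext s hs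
    rw [PMF.toMeasure_apply _ hs, Measure.sum_apply _ hs]
    refine tsum_congr fun z => ?_
    rw [Measure.smul_apply, Measure.dirac_apply' _ hs, smul_eq_mul]
    by_cases hz : z ∈ s <;> simp [hz]
  rw [h, lintegral_sum_measure]
  refine tsum_congr fun z => ?_
  rw [lintegral_smul_measure, lintegral_dirac' _ (Measurable.of_discrete), smul_eq_mul]

/-- Decreasing monotone convergence; the bound by `1` supplies the finite integral it needs. -/
theorem transition_iInf {f : ℕ → V → ℝ≥0∞} (hf : Antitone f) (h0 : ∀ x, f 0 x ≤ 1) (x : V) :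
    G.transition (fun z => ⨅ n, f n z) x = ⨅ n, G.transition (f n) x := by
  let _ : MeasurableSpace V := ⊤
  simp only [← lintegral_step]
  refine lintegral_iInf (fun n => Measurable.of_discrete) hf ?_
  refine ((lintegral_mono h0).trans_lt ?_).ne
  rw [lintegral_one, measure_univ]
  exact ENNReal.one_lt_top

theorem transition_eq_killed_add (y : V) (f : V → ℝ≥0∞) (x : V) :
    G.transition f x = G.killed y f x + f y * G.transition (({y} : Set V).indicator 1) x := by
  rw [killed, ← transition_const_mul, ← transition_add]
  congr 1
  ext z
  by_cases h : z = y <;> simp [h]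

theorem killed_mono (y : V) {f g : V → ℝ≥0∞} (h : ∀ x, f x ≤ g x) (x : V) :
    G.killed y f x ≤ G.killed y g x :=
  G.transition_mono (fun z => Set.indicator_le_indicator (h z)) x

/-! ### Hitting probabilities -/

/-- The probability of not visiting `y` at the times `1, …, n`. -/
def avoid (y : V) (n : ℕ) : V → ℝ≥0∞ := (G.killed y)^[n] fun _ => 1

theorem avoid_zero (y x : V) : G.avoid y 0 x = 1 := rfl

theorem avoid_succ (y : V) (n : ℕ) (x : V) :
    G.avoid y (n + 1) x = G.killed y (G.avoid y n) x := by
  rw [avoid, Function.iterate_succ_apply', avoid]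

theorem avoid_antitone (y : V) : Antitone (G.avoid y) := by
  refine antitone_nat_of_succ_le fun n => ?_
  induction n with
  | zero =>
    intro x
    rw [avoid_succ, avoid_zero, ← G.transition_const 1 x]
    exact G.transition_mono (fun z => Set.indicator_le_self _ _ z) x
  | succ n ih =>
    intro x
    rw [avoid_succ, avoid_succ]
    exact G.killed_mono y ih x

theorem avoid_le_one (y : V) (n : ℕ) (x : V) : G.avoid y n x ≤ 1 :=
  G.avoid_antitone y (Nat.zero_le n) x

/-! ### The law of the walk and its avoidance probabilities. -/

section Walk

variable [MeasurableSpace V] [DiscreteMeasurableSpace V]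

instance (x : V) : IsProbabilityMeasure (G.walkLaw x) := by
  unfold walkLaw; infer_instance

theorem walkLaw_zero (x : V) : ∀ᵐ Y ∂G.walkLaw x, Y 0 = x := by
  have h := Kernel.traj_map_frestrictLe_apply (X := fun _ => V)
    (κ := fun n => G.stepKernel.comap (fun h : Finset.Iic n → V => h ⟨n, Finset.mem_Iic.2 le_rfl⟩)
      (measurable_pi_apply _)) 0 0 (fun _ => x)
  have h2 : (G.walkLaw x).map (fun Y => Y 0) = Measure.dirac x := by
    have : (fun Y : ℕ → V => Y 0) = (fun h : Finset.Iic 0 → V => h ⟨0, by simp⟩) ∘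
      (Preorder.frestrictLe (π := fun _ => V) 0) := rfl
    rw [this, ← Measure.map_map (measurable_pi_apply _) (by fun_prop), walkLaw, h,
      Kernel.partialTraj_self, Kernel.id_apply, Measure.map_dirac' (measurable_pi_apply _)]
  have h3 : ∀ᵐ z ∂(G.walkLaw x).map (fun Y => Y 0), z = x := by
    rw [h2, ae_dirac_iff (MeasurableSet.of_discrete)]
  exact ae_of_ae_map (measurable_pi_apply 0).aemeasurable h3

/-- The Markov property: the joint law of the path up to time `n` and of the next position is the
composition product of the path law with the step kernel. -/
theorem lintegral_walkLaw_succ (x : V) (n : ℕ) {F : (Finset.Iic n → V) → ℝ≥0∞} (hF : Measurable F)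
    (f : V → ℝ≥0∞) :
    ∫⁻ Y, F (Preorder.frestrictLe (π := fun _ => V) n Y) * f (Y (n + 1)) ∂G.walkLaw x =
      ∫⁻ Y, F (Preorder.frestrictLe (π := fun _ => V) n Y) * G.transition f (Y n)
        ∂G.walkLaw x := by
  set κ : (n : ℕ) → Kernel (Finset.Iic n → V) V := fun n => G.stepKernel.comap
    (fun h : Finset.Iic n → V => h ⟨n, Finset.mem_Iic.2 le_rfl⟩) (measurable_pi_apply _) with hκ
  have hf : Measurable f := .of_discrete
  have h1 := Kernel.partialTraj_compProd_eq_map_traj (X := fun _ => V) (κ := κ)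
    (Nat.zero_le n) (x₀ := fun _ => x)
  have h2 := Kernel.traj_map_frestrictLe_apply (X := fun _ => V) (κ := κ) 0 n (fun _ => x)
  have e1 : ∫⁻ Y, F (Preorder.frestrictLe (π := fun _ => V) n Y) * f (Y (n + 1)) ∂G.walkLaw x =
      ∫⁻ p : (Finset.Iic n → V) × V, F p.1 * f p.2 ∂((G.walkLaw x).map
        (fun Y : ℕ → V => (Preorder.frestrictLe (π := fun _ => V) n Y, Y (n + 1)))) := by
    rw [lintegral_map (by fun_prop) (by fun_prop)]
  have e2 : ∫⁻ Y, F (Preorder.frestrictLe (π := fun _ => V) n Y) * G.transition f (Y n)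
        ∂G.walkLaw x = ∫⁻ h, F h * G.transition f (h ⟨n, Finset.mem_Iic.2 le_rfl⟩)
        ∂((G.walkLaw x).map (Preorder.frestrictLe (π := fun _ => V) n)) := by
    rw [lintegral_map _ (by fun_prop)]
    · rfl
    · exact hF.mul ((Measurable.of_discrete (f := G.transition f)).comp (measurable_pi_apply _))
  rw [e1, e2]
  change ∫⁻ p : (Finset.Iic n → V) × V, F p.1 * f p.2 ∂((Kernel.traj (X := fun _ => V) κ 0 (fun _ => x)).map _) =
    ∫⁻ h, _ ∂((Kernel.traj (X := fun _ => V) κ 0 (fun _ => x)).map _)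
  rw [h2, ← h1, Measure.lintegral_compProd (by fun_prop)]
  refine lintegral_congr fun h => ?_
  change ∫⁻ b, F h * f b ∂(κ n) h = _
  rw [lintegral_const_mul _ hf, ← lintegral_step]
  rfl

theorem lintegral_walkLaw_avoid (y x : V) (n : ℕ) (f : V → ℝ≥0∞) :
    ∫⁻ Y, {Y : ℕ → V | ∀ k, 0 < k → k ≤ n → Y k ≠ y}.indicator (fun Y => f (Y n)) Y
      ∂G.walkLaw x = (G.killed y)^[n] f x := by
  induction n generalizing f with
  | zero =>
    rw [lintegral_congr_ae (g := fun _ => f x)]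
    · simp
    · filter_upwards [G.walkLaw_zero x] with Y hY
      rw [Set.indicator_of_mem, hY]
      intro k hk hk'
      omega
  | succ n ih =>
    classical
    -- The last step of the walk is integrated out first, so the induction hypothesis is applied to
    -- `G.killed y f`; this is why `f` is generalised.
    rw [Function.iterate_succ_apply, ← ih]
    set A : Set (Finset.Iic n → V) :=
      {h | ∀ k : Finset.Iic n, 0 < k.1 → h k ≠ y} with hA
    have mA : MeasurableSet A := by
      have : A = ⋂ k : Finset.Iic n, {h | 0 < k.1 → h k ≠ y} := by ext; simp [hA]
      rw [this]
      refine MeasurableSet.iInter fun k => ?_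
      exact measurable_pi_apply (X := fun _ : Finset.Iic n => V) k
        (MeasurableSet.of_discrete (s := {z | 0 < k.1 → z ≠ y}))
    have h := G.lintegral_walkLaw_succ x n (F := A.indicator 1)
      (measurable_one.indicator mA) (({y}ᶜ : Set V).indicator f)
    have key : ∀ (Y : ℕ → V), Preorder.frestrictLe (π := fun _ => V) n Y ∈ A ↔
        ∀ k, 0 < k → k ≤ n → Y k ≠ y := by
      intro Y
      simp only [hA, Set.mem_ofPred_eq, Subtype.forall, Finset.mem_Iic]
      exact ⟨fun h k hk hn => h k hn hk, fun h k hn hk => h k hk hn⟩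
    convert h using 3 with Y Y
    · by_cases hY : ∀ k, 0 < k → k ≤ n → Y k ≠ y
      · rw [Set.indicator_of_mem ((key Y).2 hY), Pi.one_apply, one_mul]
        by_cases hn : Y (n + 1) = y
        · rw [Set.indicator_of_notMem, Set.indicator_of_notMem]
          · simp [hn]
          · exact fun h => h (n + 1) (by omega) le_rfl hn
        · rw [Set.indicator_of_mem, Set.indicator_of_mem]
          · exact hn
          · intro k hk hk'
            rcases Nat.le_succ_iff.1 hk' with h | h
            · exact hY k hk h
            · rw [h]; exact hn
      · rw [Set.indicator_of_notMem (fun h => hY ((key Y).1 h)), zero_mul,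
          Set.indicator_of_notMem]
        exact fun h => hY fun k hk hk' => h k hk (by omega)
    · by_cases hY : ∀ k, 0 < k → k ≤ n → Y k ≠ y
      · rw [Set.indicator_of_mem ((key Y).2 hY), Pi.one_apply, one_mul, Set.indicator_of_mem]
        · rfl
        · exact hY
      · rw [Set.indicator_of_notMem (fun h => hY ((key Y).1 h)), zero_mul,
          Set.indicator_of_notMem]
        exact hY

/-- Never hitting `y` is the decreasing intersection of the events of avoiding `y` up to time `n`,
so continuity from above applies. -/
theorem walkLaw_hit_eq_one_iff (x y : V) :
    G.walkLaw x {Y | ∃ k : ℕ, 0 < k ∧ Y k = y} = 1 ↔ ⨅ n, G.avoid y n x = 0 := by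
  set B : ℕ → Set (ℕ → V) := fun n => {Y : ℕ → V | ∀ k, 0 < k → k ≤ n → Y k ≠ y} with hB
  have mB : ∀ n, MeasurableSet (B n) := by
    intro n
    have : B n = ⋂ k : ℕ, {Y | 0 < k → k ≤ n → Y k ≠ y} := by ext; simp [hB]
    rw [this]
    refine MeasurableSet.iInter fun k => ?_
    exact measurable_pi_apply (X := fun _ : ℕ => V) k
        (MeasurableSet.of_discrete (s := {z | 0 < k → k ≤ n → z ≠ y}))
  have hc : {Y : ℕ → V | ∃ k : ℕ, 0 < k ∧ Y k = y} = (⋂ n, B n)ᶜ := by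
    ext Y
    simp only [hB, Set.mem_ofPred_eq, Set.mem_compl_iff, Set.mem_iInter, not_forall]
    constructor
    · rintro ⟨k, hk, h⟩
      exact ⟨k, k, hk, le_rfl, fun h' => h' h⟩
    · rintro ⟨n, k, hk, -, h⟩
      exact ⟨k, hk, not_not.1 h⟩
  have hB' : ∀ n, G.walkLaw x (B n) = G.avoid y n x := by
    intro n
    rw [avoid, ← G.lintegral_walkLaw_avoid, ← lintegral_indicator_one (mB n)]
    rfl
  rw [hc, prob_compl_eq_one_iff (MeasurableSet.iInter mB), Antitone.measure_iInter _
    (fun n => (mB n).nullMeasurableSet) ⟨0, measure_ne_top _ _⟩]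
  · simp only [hB']
  · intro m n hmn Y hY k hk hk'
    exact hY k hk (hk'.trans hmn)

end Walk

theorem recurrent_iff : G.Recurrent ↔ ∀ x y, ⨅ n, G.avoid y n x = 0 := by
  let _ : MeasurableSpace V := ⊤
  exact forall₂_congr fun x y => G.walkLaw_hit_eq_one_iff x y

end WGraph

namespace WGraph

variable {V : Type*} (G : WGraph V)

/-! ### The Green function -/

theorem forall_of_preconnected {G : WGraph V} (hG : G.toSimpleGraph.Preconnected) {p : V → Prop}
    (hp : ∀ x z, 0 < G.b x z → p x → p z) {x : V} (hx : p x) (z : V) : p z := by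
  obtain ⟨w⟩ := hG x z
  induction w with
  | nil => exact hx
  | cons h _ ih => exact ih (hp _ _ h hx)

/-- The expected number of visits to `o` at the times `0, …, N - 1`. -/
def greenUpTo (o : V) (N : ℕ) (x : V) : ℝ≥0∞ :=
  ∑ n ∈ Finset.range N, G.transition^[n] (({o} : Set V).indicator 1) x

/-- The expected number of visits to `o`. -/
def green (o x : V) : ℝ≥0∞ := ∑' n, G.transition^[n] (({o} : Set V).indicator 1) x

theorem greenUpTo_le_green (o : V) (N : ℕ) (x : V) : G.greenUpTo o N x ≤ G.green o x :=
  ENNReal.sum_le_tsum _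

theorem tendsto_greenUpTo (o x : V) :
    Filter.Tendsto (fun N => G.greenUpTo o N x) Filter.atTop (nhds (G.green o x)) :=
  ENNReal.summable.hasSum.tendsto_sum_nat

theorem green_eq (o x : V) :
    G.green o x = ({o} : Set V).indicator 1 x + G.transition (G.green o) x := by
  unfold green
  rw [transition_tsum, tsum_eq_zero_add' ENNReal.summable]
  simp only [Function.iterate_succ_apply', Function.iterate_zero, id]

theorem transition_iterate_le_one (o : V) (n : ℕ) (x : V) :
    G.transition^[n] (({o} : Set V).indicator 1) x ≤ 1 := by
  induction n generalizing x with
  | zero => exact Set.indicator_le_self _ 1 x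
  | succ n ih =>
    rw [Function.iterate_succ_apply', ← G.transition_const 1 x]
    exact G.transition_mono ih x

theorem greenUpTo_le (o : V) (N : ℕ) (x : V) : G.greenUpTo o N x ≤ N := by
  refine (Finset.sum_le_sum fun n _ => G.transition_iterate_le_one o n x).trans ?_
  simp

/-- Telescoping, arranged without subtraction, which is truncated in `ℝ≥0∞`. -/
theorem transition_greenUpTo_add (o : V) (N : ℕ) (x : V) :
    G.transition (G.greenUpTo o N) x + ({o} : Set V).indicator 1 x =
      G.greenUpTo o N x + G.transition^[N] (({o} : Set V).indicator 1) x := by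
  have h : G.transition (G.greenUpTo o N) x =
      ∑ n ∈ Finset.range N, G.transition^[n + 1] (({o} : Set V).indicator 1) x := by
    simp only [Function.iterate_succ_apply']
    induction N with
    | zero => simp [greenUpTo, transition]
    | succ N ih =>
      rw [Finset.sum_range_succ, ← ih, ← transition_add]
      congr 1
      ext z
      exact Finset.sum_range_succ _ _
  rw [h, greenUpTo, ← Finset.sum_range_succ, Finset.sum_range_succ' _ N]
  rfl

/-- The Green function is superharmonic, so stopping at `o` gives `key`. If `G.green o o` were
finite, sure hitting would yield `G.green o o ≤ G.green o x` for all `x`, and `green_eq` at `o`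
would give `1 + G.green o o ≤ G.green o o`. -/
theorem green_self_of_recurrent (h : G.Recurrent) (o : V) : G.green o o = ⊤ := by
  rw [recurrent_iff] at h
  have key : ∀ n x, G.green o o ≤ G.green o x + G.green o o * G.avoid o n x := by
    intro n
    induction n with
    | zero => intro x; rw [avoid_zero, mul_one]; exact le_add_self
    | succ n ih =>
      intro x
      have h1 : G.transition (G.green o) x ≤ G.green o x := by
        rw [G.green_eq o x]; exact le_add_self
      -- The constant is split by whether the first step enters `o`; the induction hypothesis is
      -- used only on the part that avoids `o`.
      have e1 : G.green o o = G.killed o (fun _ => G.green o o) x +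
          G.green o o * G.transition (({o} : Set V).indicator 1) x := by
        rw [← G.transition_eq_killed_add o (fun _ => G.green o o), transition_const]
      have e2 : G.killed o (fun _ => G.green o o) x ≤
          G.killed o (G.green o) x + G.green o o * G.killed o (G.avoid o n) x := by
        refine (G.killed_mono o ih x).trans_eq ?_
        simp only [killed]
        rw [← transition_const_mul, ← transition_add]
        congr 1
        ext z
        by_cases hz : z = o <;> simp [hz]
      rw [avoid_succ]
      calc G.green o o ≤ (G.killed o (G.green o) x + G.green o o * G.killed o (G.avoid o n) x) +
            G.green o o * G.transition (({o} : Set V).indicator 1) x := by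
              conv_lhs => rw [e1]
              gcongr
        _ = G.transition (G.green o) x + G.green o o * G.killed o (G.avoid o n) x := by
              rw [G.transition_eq_killed_add o (G.green o)]; ring
        _ ≤ _ := by gcongr
  by_contra htop
  have hle : ∀ x, G.green o o ≤ G.green o x := by
    intro x
    have h2 : G.green o o ≤ ⨅ n, (G.green o x + G.green o o * G.avoid o n x) :=
      le_iInf fun n => key n x
    rwa [← ENNReal.add_iInf, ← ENNReal.mul_iInf_of_ne, h x o, mul_zero, add_zero] at h2
    · intro h0
      have := G.green_eq o o
      rw [h0] at this
      simp only [Set.mem_singleton_iff, Set.indicator_of_mem, Pi.one_apply] at this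
      exact one_ne_zero (add_eq_zero.1 this.symm).1
    · exact htop
  have h3 : 1 + G.green o o ≤ G.green o o := by
    conv_rhs => rw [G.green_eq o o]
    simp only [Set.mem_singleton_iff, Set.indicator_of_mem, Pi.one_apply]
    gcongr
    rw [← G.transition_const (G.green o o) o]
    exact G.transition_mono hle o
  have h4 : G.green o o < 1 + G.green o o := by
    rw [add_comm]; exact ENNReal.lt_add_right htop one_ne_zero
  exact h4.not_ge h3

/-- With `f` the probability of never visiting `y` at a positive time, the expected number of visits
to `y` from `y` is at most `1 / f y`. -/
theorem exists_green_self_ne_top (hG : G.toSimpleGraph.Preconnected) (h : ¬ G.Recurrent) :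
    ∃ o, G.green o o ≠ ⊤ := by
  rw [recurrent_iff] at h
  push Not at h
  obtain ⟨x, y, hxy⟩ := h
  set f : V → ℝ≥0∞ := fun x => ⨅ n, G.avoid y n x with hf
  have hf_eq : ∀ x, f x = G.killed y f x := by
    intro x
    have h1 : G.killed y f x = ⨅ n, G.killed y (G.avoid y n) x := by
      unfold killed
      rw [← G.transition_iInf (f := fun n => ({y}ᶜ : Set V).indicator (G.avoid y n))]
      · congr 1
        ext z
        by_cases hz : z = y <;> simp [hz, hf]
      · intro m n hmn z
        exact Set.indicator_le_indicator (G.avoid_antitone y hmn z)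
      · exact fun z => Set.indicator_le_self _ _ z
    rw [h1, hf]
    simp only [← avoid_succ]
    refine le_antisymm (le_iInf fun n => iInf_le _ _) (le_iInf fun n => ?_)
    exact (iInf_le _ n).trans (G.avoid_antitone y n.le_succ x)
  -- A zero of `f` spreads to neighbours because `f` is harmonic for the killed walk; starting at
  -- `y` it would reach the vertex `x` where `f` is positive.
  have hfy : f y ≠ 0 := by
    intro h0
    refine hxy (forall_of_preconnected hG (p := fun x => f x = 0) ?_ h0 x)
    intro x z hb hx
    by_cases hz : z = y
    · rw [hz]; exact h0
    · rw [hf_eq] at hx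
      have := ENNReal.tsum_eq_zero.1 hx z
      rw [mul_eq_zero, or_iff_right (G.step_ne_zero hb)] at this
      rwa [Set.indicator_of_mem (show z ∈ ({y}ᶜ : Set V) from hz)] at this
  have hf1 : ∀ x, f x ≤ 1 := fun x => (iInf_le _ 0).trans (G.avoid_le_one y 0 x)
  -- Setting `f` to zero at `y` turns killed harmonicity into `G.transition f' = f' + f y · 1_y`.
  -- The source term is exactly what `greenUpTo` gains per step, so `f' + f y · greenUpTo` stays
  -- below `1`.
  set f' : V → ℝ≥0∞ := ({y}ᶜ : Set V).indicator f with hf'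
  have hTf' : ∀ x, G.transition f' x = f' x + f y * ({y} : Set V).indicator 1 x := by
    intro x
    change G.killed y f x = _
    rw [← hf_eq]
    by_cases hz : x = y <;> simp [hz, hf']
  have key : ∀ N x, f' x + f y * G.greenUpTo y N x ≤ 1 := by
    intro N
    induction N with
    | zero =>
      intro x
      simp only [greenUpTo, Finset.range_zero, Finset.sum_empty, mul_zero, add_zero]
      exact (Set.indicator_le_self _ _ x).trans (hf1 x)
    | succ N ih =>
      intro x
      have e : G.greenUpTo y (N + 1) x =
          ({y} : Set V).indicator 1 x + G.transition (G.greenUpTo y N) x := by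
        rw [add_comm (({y} : Set V).indicator 1 x), transition_greenUpTo_add, greenUpTo, Finset.sum_range_succ, greenUpTo]
      rw [e, mul_add, ← add_assoc, ← hTf', ← transition_const_mul, ← transition_add,
        ← G.transition_const 1 x]
      exact G.transition_mono ih x
  refine ⟨y, fun htop => ?_⟩
  have h1 : f y * G.green y y ≤ 1 := by
    rw [green, ENNReal.tsum_eq_iSup_nat, ENNReal.mul_iSup]
    exact iSup_le fun N => le_add_self.trans (key N y)
  rw [htop, ENNReal.mul_top hfy] at h1
  simp at h1

/-- A vertex of degree zero is absorbing, hence visited infinitely often from itself. -/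
theorem deg_pos_of_green_ne_top {o : V} (h : G.green o o ≠ ⊤) : 0 < G.deg o := by
  rcases (G.deg_nonneg o).lt_or_eq with h0 | h0
  · exact h0
  · exfalso
    have hs : G.step o = PMF.pure o := by
      rw [step, dif_pos]
      rw [← ofReal_deg, ← h0, ENNReal.ofReal_zero]
    have ht : G.transition (G.green o) o = G.green o o := by
      rw [transition, hs, tsum_eq_single o]
      · simp
      · intro z hz; simp [hz]
    have h1 := G.green_eq o o
    rw [ht] at h1
    simp only [Set.mem_singleton_iff, Set.indicator_of_mem, Pi.one_apply] at h1
    have h4 : G.green o o < 1 + G.green o o := by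
      rw [add_comm]; exact ENNReal.lt_add_right h one_ne_zero
    exact h4.ne h1

theorem green_ne_top {o : V} (hG : G.toSimpleGraph.Preconnected) (h : G.green o o ≠ ⊤) (x : V) :
    G.green o x ≠ ⊤ := by
  refine forall_of_preconnected hG (p := fun x => G.green o x ≠ ⊤) ?_ h x
  intro x z hb hx hz
  refine hx ?_
  rw [green_eq, transition, ENNReal.tsum_eq_top_of_eq_top ⟨z, ?_⟩, add_top]
  rw [hz, ENNReal.mul_top (G.step_ne_zero hb)]

/-! ### The energy of the Green function -/

/-- By reversibility `deg` is an invariant measure. -/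
theorem tsum_deg_mul_transition (f : V → ℝ≥0∞) :
    ∑' x, ENNReal.ofReal (G.deg x) * G.transition f x = ∑' x, ENNReal.ofReal (G.deg x) * f x := by
  simp only [ofReal_deg_mul_transition]
  simp only [ofReal_deg, ← ENNReal.tsum_mul_right]
  rw [ENNReal.tsum_comm]
  exact tsum_congr fun x => tsum_congr fun z => by rw [G.symm]

theorem tsum_deg_mul_greenUpTo (o : V) (N : ℕ) :
    ∑' x, ENNReal.ofReal (G.deg x) * G.greenUpTo o N x = N * ENNReal.ofReal (G.deg o) := by
  have h : ∀ n, ∑' x, ENNReal.ofReal (G.deg x) *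
      G.transition^[n] (({o} : Set V).indicator 1) x = ENNReal.ofReal (G.deg o) := by
    intro n
    induction n with
    | zero =>
      rw [tsum_eq_single o]
      · simp
      · intro z hz; simp [hz]
    | succ n ih => rw [Function.iterate_succ_apply', tsum_deg_mul_transition, ih]
  induction N with
  | zero => simp [greenUpTo]
  | succ N ih =>
    simp only [greenUpTo, Finset.sum_range_succ, mul_add, ENNReal.tsum_add] at ih ⊢
    rw [ih, h]
    push_cast
    ring

/-- The energy of a real function, as an extended nonnegative number. -/
def energy (f : V → ℝ) : ℝ≥0∞ := ∑' x, ∑' z, ENNReal.ofReal (G.b x z * (f x - f z) ^ 2)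

/-- Green's formula, obtained by expanding the square. The factors `2` appear because `energy`
counts every edge in both orientations. -/
theorem energy_add (g : V → ℝ≥0∞) (hg : ∀ x, g x ≠ ⊤) :
    G.energy (fun x => (g x).toReal) + 2 * ∑' x, ENNReal.ofReal (G.deg x) * (g x * G.transition g x)
      = 2 * ∑' x, ENNReal.ofReal (G.deg x) * g x ^ 2 := by
  have e1 : ∑' x, ENNReal.ofReal (G.deg x) * (g x * G.transition g x) =
      ∑' x, ∑' z, ENNReal.ofReal (G.b x z) * (g x * g z) := by
    refine tsum_congr fun x => ?_
    rw [mul_left_comm, ofReal_deg_mul_transition, ← ENNReal.tsum_mul_left]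
    exact tsum_congr fun z => by ring
  have e2 : ∑' x, ENNReal.ofReal (G.deg x) * g x ^ 2 =
      ∑' x, ∑' z, ENNReal.ofReal (G.b x z) * g x ^ 2 := by
    refine tsum_congr fun x => ?_
    rw [ofReal_deg, ENNReal.tsum_mul_right]
  have e3 : ∑' x, ∑' z, ENNReal.ofReal (G.b x z) * g x ^ 2 =
      ∑' x, ∑' z, ENNReal.ofReal (G.b x z) * g z ^ 2 := by
    rw [ENNReal.tsum_comm]
    exact tsum_congr fun x => tsum_congr fun z => by rw [G.symm]
  rw [e1, e2, two_mul (∑' x, ∑' z, ENNReal.ofReal (G.b x z) * g x ^ 2)]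
  nth_rewrite 2 [e3]
  simp only [energy, ← ENNReal.tsum_mul_left, ← ENNReal.tsum_add]
  refine tsum_congr fun x => tsum_congr fun z => ?_
  obtain ⟨a, ha⟩ : ∃ a : NNReal, g x = a := ⟨_, (ENNReal.coe_toNNReal (hg x)).symm⟩
  obtain ⟨c, hc⟩ : ∃ c : NNReal, g z = c := ⟨_, (ENNReal.coe_toNNReal (hg z)).symm⟩
  have h : ENNReal.ofReal (((a : ℝ) - c) ^ 2) + 2 * (a * c : ℝ≥0∞) = (a : ℝ≥0∞) ^ 2 + c ^ 2 := by
    have h2 : (2 : ℝ≥0∞) * (a * c) = ENNReal.ofReal (2 * (a * c)) := by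
      rw [ENNReal.ofReal_mul zero_le_two, ENNReal.ofReal_mul a.coe_nonneg]
      simp
    have h3 : (a : ℝ≥0∞) ^ 2 + c ^ 2 = ENNReal.ofReal (a ^ 2 + c ^ 2) := by
      rw [ENNReal.ofReal_add (by positivity) (by positivity), ENNReal.ofReal_pow a.coe_nonneg,
        ENNReal.ofReal_pow c.coe_nonneg]
      simp
    rw [h2, h3, ← ENNReal.ofReal_add (by positivity) (by positivity)]
    congr 1
    ring
  rw [ha, hc, ENNReal.coe_toReal, ENNReal.coe_toReal, ENNReal.ofReal_mul (G.nonneg x z), ← mul_add,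
    ← h]
  ring

/-- By `transition_greenUpTo_add`, `g ≤ G.transition g + 1_o`. Multiplying by `deg · g` and summing
leaves only the term at `o` in Green's formula. -/
theorem energy_greenUpTo_le (o : V) (N : ℕ) :
    G.energy (fun x => (G.greenUpTo o N x).toReal) ≤
      2 * (ENNReal.ofReal (G.deg o) * G.greenUpTo o N o) := by
  set g := G.greenUpTo o N with hg
  have hfin : ∀ x, g x ≠ ⊤ := fun x => ((G.greenUpTo_le o N x).trans_lt
    (ENNReal.natCast_lt_top N)).ne
  have h1 := G.energy_add g hfin
  have h2 : ∑' x, ENNReal.ofReal (G.deg x) * g x ^ 2 ≤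
      ∑' x, ENNReal.ofReal (G.deg x) * (g x * G.transition g x) +
        ENNReal.ofReal (G.deg o) * g o := by
    have h3 : ∀ x, ENNReal.ofReal (G.deg x) * g x ^ 2 ≤
        ENNReal.ofReal (G.deg x) * (g x * G.transition g x) +
          ENNReal.ofReal (G.deg x) * (g x * ({o} : Set V).indicator 1 x) := by
      intro x
      rw [← mul_add, ← mul_add, hg, transition_greenUpTo_add, pow_two]
      gcongr
      exact le_self_add
    refine (ENNReal.tsum_le_tsum h3).trans_eq ?_
    rw [ENNReal.tsum_add]
    congr 1
    rw [tsum_eq_single o]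
    · simp
    · intro z hz; simp [hz]
  -- Finiteness is needed to cancel this sum in `ℝ≥0∞`; it is why the walk is stopped at a finite
  -- time.
  have h4 : ∑' x, ENNReal.ofReal (G.deg x) * (g x * G.transition g x) ≠ ⊤ := by
    have h5 : ∀ x, ENNReal.ofReal (G.deg x) * (g x * G.transition g x) ≤
        N * (ENNReal.ofReal (G.deg x) * g x) := by
      intro x
      have : G.transition g x ≤ N := by
        rw [← G.transition_const N x]; exact G.transition_mono (G.greenUpTo_le o N) x
      calc ENNReal.ofReal (G.deg x) * (g x * G.transition g x)
          ≤ ENNReal.ofReal (G.deg x) * (g x * N) := by gcongr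
        _ = _ := by ring
    refine ((ENNReal.tsum_le_tsum h5).trans_lt ?_).ne
    rw [ENNReal.tsum_mul_left, tsum_deg_mul_greenUpTo]
    exact ENNReal.mul_lt_top (ENNReal.natCast_lt_top N)
      (ENNReal.mul_lt_top (ENNReal.natCast_lt_top N) ENNReal.ofReal_lt_top)
  rw [← ENNReal.add_le_add_iff_right (ENNReal.mul_ne_top (ENNReal.ofNat_ne_top (n := 2)) h4), h1,
    ← mul_add]
  gcongr
  rwa [add_comm]

end WGraph

namespace WGraph

variable {V : Type*} (G : WGraph V)

/-! ### Null sequences and monopoles -/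

theorem energy_eq_tsum (f : V → ℝ) :
    G.energy f = ∑' p : V × V, ENNReal.ofReal (G.b p.1 p.2 * (f p.1 - f p.2) ^ 2) :=
  (ENNReal.tsum_prod (f := fun x z => ENNReal.ofReal (G.b x z * (f x - f z) ^ 2))).symm

theorem summable_of_energy_ne_top {f : V → ℝ} (h : G.energy f ≠ ⊤) :
    Summable fun p : V × V => G.b p.1 p.2 * (f p.1 - f p.2) ^ 2 := by
  rw [energy_eq_tsum] at h
  refine (ENNReal.summable_toReal h).congr fun p => ?_
  exact ENNReal.toReal_ofReal (mul_nonneg (G.nonneg _ _) (sq_nonneg _))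

theorem tsum_energy (f : V → ℝ) :
    ∑' p : V × V, G.b p.1 p.2 * (f p.1 - f p.2) ^ 2 = (G.energy f).toReal := by
  rw [energy_eq_tsum, ENNReal.tsum_toReal_eq fun _ => ENNReal.ofReal_ne_top]
  refine tsum_congr fun p => ?_
  exact (ENNReal.toReal_ofReal (mul_nonneg (G.nonneg _ _) (sq_nonneg _))).symm

theorem edge_le_energy (f : V → ℝ) (x z : V) :
    ENNReal.ofReal (G.b x z * (f x - f z) ^ 2) ≤ G.energy f := by
  rw [energy_eq_tsum]
  exact ENNReal.le_tsum (f := fun p : V × V =>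
    ENNReal.ofReal (G.b p.1 p.2 * (f p.1 - f p.2) ^ 2)) (x, z)

/-- A sequence of `ℓ¹`-functions with values in `[0, 1]` which tends to `1` pointwise and to `0` in
energy. -/
structure IsNullSequence (e : ℕ → V → ℝ) : Prop where
  nonneg : ∀ n x, 0 ≤ e n x
  le_one : ∀ n x, e n x ≤ 1
  summable : ∀ n, Summable fun x => G.deg x * e n x
  energy_ne_top : ∀ n, G.energy (e n) ≠ ⊤
  tendsto_energy : Tendsto (fun n => G.energy (e n)) atTop (𝓝 0)
  tendsto_one : ∀ x, Tendsto (fun n => e n x) atTop (𝓝 1)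

/-- Vanishing energy forces the difference across each single edge to zero, so the limit at `o`
propagates along paths. -/
theorem tendsto_one_of_energy (hG : G.toSimpleGraph.Preconnected) {e : ℕ → V → ℝ} {o : V}
    (ho : Tendsto (fun n => e n o) atTop (𝓝 1))
    (he : Tendsto (fun n => G.energy (e n)) atTop (𝓝 0)) (x : V) :
    Tendsto (fun n => e n x) atTop (𝓝 1) := by
  refine forall_of_preconnected hG (p := fun x => Tendsto (fun n => e n x) atTop (𝓝 1)) ?_ ho x
  intro x z hb hx
  have h1 : Tendsto (fun n => ENNReal.ofReal (G.b x z * (e n x - e n z) ^ 2)) atTop (𝓝 0) :=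
    tendsto_of_tendsto_of_tendsto_of_le_of_le tendsto_const_nhds he (fun _ => zero_le)
      fun n => G.edge_le_energy (e n) x z
  have h2 : Tendsto (fun n => G.b x z * (e n x - e n z) ^ 2) atTop (𝓝 0) := by
    have := (ENNReal.tendsto_toReal ENNReal.zero_ne_top).comp h1
    refine this.congr fun n => ?_
    exact ENNReal.toReal_ofReal (mul_nonneg (G.nonneg _ _) (sq_nonneg _))
  have h3 : Tendsto (fun n => (e n x - e n z) ^ 2) atTop (𝓝 0) := by
    have := h2.const_mul (G.b x z)⁻¹
    rw [mul_zero] at this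
    refine this.congr fun n => ?_
    rw [inv_mul_cancel_left₀ hb.ne']
  have h4 : Tendsto (fun n => |e n x - e n z|) atTop (𝓝 0) := by
    have := (Real.continuous_sqrt.tendsto 0).comp h3
    rw [Real.sqrt_zero] at this
    exact this.congr fun n => Real.sqrt_sq_eq_abs _
  have h5 := hx.sub ((tendsto_zero_iff_abs_tendsto_zero _).2 h4)
  rw [sub_zero] at h5
  exact h5.congr fun n => by ring

theorem energy_min_div_le (f : V → ℝ) (c : ℝ) :
    G.energy (fun x => min (f x / c) 1) ≤ ENNReal.ofReal (c⁻¹ ^ 2) * G.energy f := by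
  simp only [energy, ← ENNReal.tsum_mul_left]
  refine ENNReal.tsum_le_tsum fun x => ENNReal.tsum_le_tsum fun z => ?_
  rw [← ENNReal.ofReal_mul (sq_nonneg _)]
  refine ENNReal.ofReal_le_ofReal ?_
  have h1 : |min (f x / c) 1 - min (f z / c) 1| ≤ |f x / c - f z / c| := by
    have := abs_min_sub_min_le_max (f x / c) 1 (f z / c) 1
    rwa [sub_self, abs_zero, max_eq_left (abs_nonneg _)] at this
  have h2 := sq_le_sq.2 h1
  calc G.b x z * (min (f x / c) 1 - min (f z / c) 1) ^ 2
      ≤ G.b x z * (f x / c - f z / c) ^ 2 := mul_le_mul_of_nonneg_left h2 (G.nonneg _ _)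
    _ = _ := by rw [div_eq_mul_inv, div_eq_mul_inv]; ring

theorem exists_isNullSequence (hG : G.toSimpleGraph.Preconnected) (h : G.Recurrent) (o : V) :
    ∃ e, G.IsNullSequence e := by
  have hfin : ∀ N x, G.greenUpTo o N x ≠ ⊤ := fun N x => ((G.greenUpTo_le o N x).trans_lt
    (ENNReal.natCast_lt_top N)).ne
  -- The shift to `N + 1` counts the visit at time `0`, so that `c N ≥ 1` can be divided by.
  set c : ℕ → ℝ := fun N => (G.greenUpTo o (N + 1) o).toReal with hc
  have hc1 : ∀ N, 1 ≤ c N := by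
    intro N
    rw [← ENNReal.ofReal_le_iff_le_toReal (hfin _ _), ENNReal.ofReal_one, greenUpTo,
      Finset.sum_range_succ']
    simp
  have hct : Tendsto c atTop atTop := by
    have h1 := (G.tendsto_greenUpTo o o).comp (tendsto_add_atTop_nat 1)
    rw [G.green_self_of_recurrent h, ENNReal.tendsto_nhds_top_iff_nat] at h1
    refine tendsto_atTop.2 fun b => ?_
    obtain ⟨k, hk⟩ := exists_nat_ge b
    filter_upwards [h1 k] with N hN
    refine hk.trans ?_
    have := ENNReal.toReal_mono (hfin (N + 1) o) hN.le
    simpa using this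
  -- Cutting at `1` does not increase the energy and makes a maximum principle for `greenUpTo`
  -- unnecessary.
  set e : ℕ → V → ℝ := fun N x => min ((G.greenUpTo o (N + 1) x).toReal / c N) 1 with he
  have hE : ∀ N, G.energy (e N) ≤ ENNReal.ofReal (2 * G.deg o * (c N)⁻¹) := by
    intro N
    refine (G.energy_min_div_le _ _).trans ?_
    have h1 := G.energy_greenUpTo_le o (N + 1)
    calc _ ≤ ENNReal.ofReal ((c N)⁻¹ ^ 2) *
          (2 * (ENNReal.ofReal (G.deg o) * G.greenUpTo o (N + 1) o)) := by gcongr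
      _ = ENNReal.ofReal ((c N)⁻¹ ^ 2) *
          (ENNReal.ofReal 2 * (ENNReal.ofReal (G.deg o) * ENNReal.ofReal (c N))) := by
        rw [hc, ENNReal.ofReal_toReal (hfin _ _), ENNReal.ofReal_ofNat]
      _ = _ := by
        rw [← ENNReal.ofReal_mul (G.deg_nonneg o), ← ENNReal.ofReal_mul zero_le_two,
          ← ENNReal.ofReal_mul (sq_nonneg _)]
        congr 1
        have := (zero_lt_one.trans_le (hc1 N)).ne'
        field_simp
  have hEt : Tendsto (fun N => G.energy (e N)) atTop (𝓝 0) := by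
    refine tendsto_of_tendsto_of_tendsto_of_le_of_le tendsto_const_nhds ?_ (fun _ => zero_le) hE
    have h1 := (tendsto_inv_atTop_zero.comp hct).const_mul (2 * G.deg o)
    rw [mul_zero] at h1
    have := ENNReal.tendsto_ofReal h1
    rwa [ENNReal.ofReal_zero] at this
  have he0 : ∀ N x, 0 ≤ e N x := fun N x =>
    le_min (div_nonneg ENNReal.toReal_nonneg (zero_le_one.trans (hc1 N))) zero_le_one
  refine ⟨e, he0, fun N x => min_le_right _ _, fun N => ?_,
    fun N => ((hE N).trans_lt ENNReal.ofReal_lt_top).ne, hEt, ?_⟩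
  · have h1 : Summable fun x => (ENNReal.ofReal (G.deg x) * G.greenUpTo o (N + 1) x).toReal := by
      refine ENNReal.summable_toReal ?_
      rw [tsum_deg_mul_greenUpTo]
      exact ENNReal.mul_ne_top (ENNReal.natCast_ne_top _) ENNReal.ofReal_ne_top
    refine Summable.of_nonneg_of_le (fun x => mul_nonneg (G.deg_nonneg x) (he0 N x))
      (fun x => ?_) h1
    rw [ENNReal.toReal_mul, ENNReal.toReal_ofReal (G.deg_nonneg x)]
    refine mul_le_mul_of_nonneg_left ((min_le_left _ _).trans ?_) (G.deg_nonneg x)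
    exact div_le_self ENNReal.toReal_nonneg (hc1 N)
  · refine G.tendsto_one_of_energy hG (o := o) ?_ hEt
    refine tendsto_const_nhds.congr fun N => ?_
    have h1 : (G.greenUpTo o (N + 1) o).toReal / c N = 1 :=
      div_self (zero_lt_one.trans_le (hc1 N)).ne'
    rw [he]
    simp only [h1, min_self]

/-- Lower semicontinuity of the energy: each finite partial sum is a limit of those of `greenUpTo`,
whose energies are bounded uniformly in `N`. -/
theorem energy_green_ne_top {o : V} (hfin : ∀ x, G.green o x ≠ ⊤) :
    G.energy (fun x => (G.green o x).toReal) ≠ ⊤ := by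
  have hle : G.energy (fun x => (G.green o x).toReal) ≤
      2 * (ENNReal.ofReal (G.deg o) * G.green o o) := by
    rw [energy_eq_tsum, ENNReal.tsum_eq_iSup_sum]
    refine iSup_le fun s => ?_
    have ht : ∀ x, Tendsto (fun N => (G.greenUpTo o N x).toReal) atTop
        (𝓝 (G.green o x).toReal) := fun x =>
      (ENNReal.tendsto_toReal (hfin x)).comp (G.tendsto_greenUpTo o x)
    have h1 : Tendsto (fun N => ∑ p ∈ s, ENNReal.ofReal (G.b p.1 p.2 *
        ((G.greenUpTo o N p.1).toReal - (G.greenUpTo o N p.2).toReal) ^ 2)) atTop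
        (𝓝 (∑ p ∈ s, ENNReal.ofReal (G.b p.1 p.2 *
        ((G.green o p.1).toReal - (G.green o p.2).toReal) ^ 2))) :=
      tendsto_finsetSum _ fun p _ => ENNReal.tendsto_ofReal
        ((((ht p.1).sub (ht p.2)).pow 2).const_mul _)
    refine le_of_tendsto' h1 fun N => ?_
    refine (ENNReal.sum_le_tsum s).trans ?_
    rw [← G.energy_eq_tsum fun x => (G.greenUpTo o N x).toReal]
    refine (G.energy_greenUpTo_le o N).trans ?_
    gcongr
    exact G.greenUpTo_le_green o N o
  refine (hle.trans_lt ?_).ne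
  exact ENNReal.mul_lt_top (by simp) (ENNReal.mul_lt_top ENNReal.ofReal_lt_top (hfin o).lt_top)

theorem hasSum_b_mul_green {o : V} (hfin : ∀ x, G.green o x ≠ ⊤) (x : V) :
    HasSum (fun z => G.b x z * (G.green o z).toReal)
      (G.deg x * (G.transition (G.green o) x).toReal) := by
  have hT : G.transition (G.green o) x ≠ ⊤ := by
    refine ne_top_of_le_ne_top (hfin x) ?_
    rw [G.green_eq o x]
    exact le_add_self
  have h1 := G.ofReal_deg_mul_transition (G.green o) x
  have h2 : ∑' z, ENNReal.ofReal (G.b x z) * G.green o z ≠ ⊤ := by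
    rw [← h1]; exact ENNReal.mul_ne_top ENNReal.ofReal_ne_top hT
  have h3 := ENNReal.hasSum_toReal h2
  rw [← ENNReal.tsum_toReal_eq (ENNReal.ne_top_of_tsum_ne_top h2), ← h1, ENNReal.toReal_mul,
    ENNReal.toReal_ofReal (G.deg_nonneg x)] at h3
  refine h3.congr_fun fun z => ?_
  rw [ENNReal.toReal_mul, ENNReal.toReal_ofReal (G.nonneg x z)]

theorem hasSum_green_sub {o : V} (hfin : ∀ x, G.green o x ≠ ⊤) (x : V) :
    HasSum (fun z => G.b x z * ((G.green o x).toReal - (G.green o z).toReal))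
      (({o} : Set V).indicator G.deg x) := by
  have h0 : HasSum (G.b x) (G.deg x) := (G.summable x).hasSum
  have h1 := (h0.mul_right (G.green o x).toReal).sub (G.hasSum_b_mul_green hfin x)
  have hT : G.transition (G.green o) x ≠ ⊤ := by
    refine ne_top_of_le_ne_top (hfin x) ?_
    rw [G.green_eq o x]
    exact le_add_self
  have h2 : (G.green o x).toReal =
      (({o} : Set V).indicator (1 : V → ℝ≥0∞) x).toReal + (G.transition (G.green o) x).toReal := by
    rw [← ENNReal.toReal_add _ hT, ← green_eq]
    by_cases hx : x = o <;> simp [hx]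
  have h3 : ({o} : Set V).indicator G.deg x = G.deg x * (G.green o x).toReal -
      G.deg x * (G.transition (G.green o) x).toReal := by
    rw [h2, mul_add, add_sub_cancel_right]
    by_cases hx : x = o <;> simp [hx]
  rw [h3]
  simpa only [mul_sub] using h1

theorem exists_finite_energy_dipole (hG : G.toSimpleGraph.Preconnected) (h : ¬ G.Recurrent) :
    ∃ o, 0 < G.deg o ∧ ∃ f : V → ℝ,
      (Summable fun p : V × V => G.b p.1 p.2 * (f p.1 - f p.2) ^ 2) ∧
      ∀ x, HasSum (fun z => G.b x z * (f x - f z)) (({o} : Set V).indicator G.deg x) := by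
  obtain ⟨o, ho⟩ := G.exists_green_self_ne_top hG h
  have hfin := G.green_ne_top hG ho
  have hs := G.summable_of_energy_ne_top (G.energy_green_ne_top hfin)
  exact ⟨o, G.deg_pos_of_green_ne_top ho, fun x => (G.green o x).toReal, hs,
    G.hasSum_green_sub hfin⟩

/-! ### Flows of finite energy -/

/-- The divergence paired with `e n` is half the pairing of `φ` with the gradient of `e n`, which
tends to zero with the energy of `e n`; by dominated convergence the left side tends to the total
divergence. -/
theorem tsum_divergence_eq_zero {e : ℕ → V → ℝ} (he : G.IsNullSequence e) {φ : V → V → ℂ}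
    (hφ : ∀ x z, φ z x = -φ x z) (hE : Summable fun p : V × V => G.b p.1 p.2 * ‖φ p.1 p.2‖ ^ 2)
    (hdiv : Summable fun x => ‖∑' z, (G.b x z : ℂ) * φ x z‖) :
    ∑' x, ∑' z, (G.b x z : ℂ) * φ x z = 0 := by
  set D : V → ℂ := fun x => ∑' z, (G.b x z : ℂ) * φ x z with hD
  set E : ℝ := ∑' p : V × V, G.b p.1 p.2 * ‖φ p.1 p.2‖ ^ 2 with hEdef
  have hE0 : 0 ≤ E := tsum_nonneg fun p => mul_nonneg (G.nonneg _ _) (sq_nonneg _)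
  have hbe : ∀ n, Summable fun p : V × V => G.b p.1 p.2 * e n p.1 := by
    intro n
    have h0 : 0 ≤ fun p : V × V => G.b p.1 p.2 * e n p.1 :=
      fun p => mul_nonneg (G.nonneg _ _) (he.nonneg _ _)
    rw [summable_prod_of_nonneg h0]
    have h1 : ∀ x, Summable fun z => G.b x z * e n x := fun x => (G.summable x).mul_right _
    refine ⟨h1, (he.summable n).congr fun x => ?_⟩
    exact tsum_mul_right.symm
  -- Absolute convergence justifies the interchange of sums and the swap of orientations below; it
  -- is where the `ℓ¹` condition on `e n` enters.
  have hs : ∀ n, Summable fun p : V × V => (G.b p.1 p.2 : ℂ) * φ p.1 p.2 * e n p.1 := by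
    intro n
    refine Summable.of_norm_bounded ((hbe n).add hE) fun p => ?_
    rw [norm_mul, norm_mul, Complex.norm_real, Complex.norm_real, Real.norm_of_nonneg (G.nonneg _ _),
      Real.norm_of_nonneg (he.nonneg _ _), mul_assoc, ← mul_add]
    refine mul_le_mul_of_nonneg_left ?_ (G.nonneg _ _)
    have h0 := he.nonneg n p.1
    have h1 := he.le_one n p.1
    nlinarith [sq_nonneg (‖φ p.1 p.2‖ - e n p.1), norm_nonneg (φ p.1 p.2)]
  have hS : ∀ n, 2 * ∑' x, D x * e n x =
      ∑' p : V × V, (G.b p.1 p.2 : ℂ) * φ p.1 p.2 * (e n p.1 - e n p.2 : ℝ) := by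
    intro n
    have e1 : ∑' x, D x * e n x =
        ∑' p : V × V, (G.b p.1 p.2 : ℂ) * φ p.1 p.2 * e n p.1 := by
      rw [(hs n).tsum_prod]
      exact tsum_congr fun x => tsum_mul_right.symm
    have hs2 : Summable fun p : V × V => (G.b p.1 p.2 : ℂ) * φ p.1 p.2 * e n p.2 := by
      refine ((Equiv.prodComm V V).summable_iff.2 (hs n)).neg.congr fun p => ?_
      simp only [Function.comp_apply, Equiv.prodComm_apply, Prod.fst_swap, Prod.snd_swap]
      rw [G.symm, hφ p.1 p.2]
      ring
    have e2 : ∑' p : V × V, (G.b p.1 p.2 : ℂ) * φ p.1 p.2 * e n p.2 =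
        -∑' p : V × V, (G.b p.1 p.2 : ℂ) * φ p.1 p.2 * e n p.1 := by
      rw [← (Equiv.prodComm V V).tsum_eq, ← tsum_neg]
      refine tsum_congr fun p => ?_
      simp only [Equiv.prodComm_apply, Prod.fst_swap, Prod.snd_swap]
      rw [G.symm, hφ p.1 p.2]
      ring
    have e3 := (hs n).tsum_sub hs2
    rw [e2] at e3
    rw [e1, two_mul]
    rw [sub_neg_eq_add] at e3
    rw [← e3]
    refine tsum_congr fun p => ?_
    push_cast
    ring
  -- A weighted arithmetic-geometric inequality takes the place of Cauchy–Schwarz: `n` tends to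
  -- infinity for fixed `t`, and `t` is chosen small afterwards.
  have hbound : ∀ t : ℝ, 0 < t → ∀ n,
      ‖2 * ∑' x, D x * e n x‖ ≤ t⁻¹ * (G.energy (e n)).toReal + t * E := by
    intro t ht n
    have hs1 := (G.summable_of_energy_ne_top (he.energy_ne_top n)).mul_left t⁻¹
    have hs2 := hE.mul_left t
    rw [hS n, ← tsum_energy, hEdef, ← tsum_mul_left, ← tsum_mul_left, ← hs1.tsum_add hs2]
    refine tsum_of_norm_bounded (hs1.add hs2).hasSum fun p => ?_
    rw [norm_mul, norm_mul, Complex.norm_real, Complex.norm_real, Real.norm_of_nonneg (G.nonneg _ _),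
      Real.norm_eq_abs]
    have key : ‖φ p.1 p.2‖ * |e n p.1 - e n p.2| ≤
        t⁻¹ * (e n p.1 - e n p.2) ^ 2 + t * ‖φ p.1 p.2‖ ^ 2 := by
      rw [← sq_abs (e n p.1 - e n p.2)]
      set a := ‖φ p.1 p.2‖
      set c := |e n p.1 - e n p.2|
      have ha : 0 ≤ a := norm_nonneg _
      have hc : 0 ≤ c := abs_nonneg _
      have : t⁻¹ * c ^ 2 + t * a ^ 2 - a * c = t⁻¹ * ((c - t * a) ^ 2 + c * (t * a)) := by
        field_simp
        ring
      have h2 : 0 ≤ t⁻¹ * ((c - t * a) ^ 2 + c * (t * a)) := by positivity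
      linarith
    have := mul_le_mul_of_nonneg_left key (G.nonneg p.1 p.2)
    linarith
  have hlim : Tendsto (fun n => ∑' x, D x * e n x) atTop (𝓝 (∑' x, D x)) := by
    refine tendsto_tsum_of_dominated_convergence hdiv (fun x => ?_) (Eventually.of_forall ?_)
    · have h1 : Tendsto (fun n => ((e n x : ℝ) : ℂ)) atTop (𝓝 ((1 : ℝ) : ℂ)) :=
        (Complex.continuous_ofReal.tendsto 1).comp (he.tendsto_one x)
      have := h1.const_mul (D x)
      simpa using this
    · intro n x
      rw [norm_mul, Complex.norm_real, Real.norm_of_nonneg (he.nonneg n x)]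
      exact mul_le_of_le_one_right (norm_nonneg _) (he.le_one n x)
  have hE2 : Tendsto (fun n => (G.energy (e n)).toReal) atTop (𝓝 0) :=
    (ENNReal.tendsto_toReal ENNReal.zero_ne_top).comp he.tendsto_energy
  have hfinal : ∀ t : ℝ, 0 < t → ‖2 * ∑' x, D x‖ ≤ t * E := by
    intro t ht
    have h1 := (hE2.const_mul t⁻¹).add_const (t * E)
    rw [mul_zero, zero_add] at h1
    exact le_of_tendsto_of_tendsto' (hlim.const_mul 2).norm h1 (hbound t ht)
  by_contra hne
  have hpos : 0 < ‖2 * ∑' x, D x‖ := norm_pos_iff.2 (mul_ne_zero two_ne_zero hne)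
  have h1 := hfinal (‖2 * ∑' x, D x‖ / (2 * (E + 1))) (by positivity)
  have h2 : ‖2 * ∑' x, D x‖ / (2 * (E + 1)) * E < ‖2 * ∑' x, D x‖ := by
    rw [div_mul_eq_mul_div, div_lt_iff₀ (by positivity)]
    nlinarith
  exact h2.not_ge h1

end WGraph

namespace WGraph

variable {V : Type*} (G : WGraph V)

/-! ### Passage to connected components -/

theorem component_preconnected (c : G.toSimpleGraph.ConnectedComponent) :
    (G.component c).toSimpleGraph.Preconnected :=
  c.connected_toSimpleGraph.preconnected

theorem b_eq_zero_of_notMem_supp (c : G.toSimpleGraph.ConnectedComponent) {x z : V}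
    (hx : x ∈ c.supp) (hz : z ∉ c.supp) : G.b x z = 0 := by
  by_contra h
  have hadj : G.toSimpleGraph.Adj x z := lt_of_le_of_ne (G.nonneg x z) (Ne.symm h)
  exact hz ((c.mem_supp_congr_adj hadj).1 hx)

/-- The Green function of the component is extended by zero, which creates no energy as no edge
leaves the component. The factor `a` turns the source `deg o` into `μ o`. -/
theorem exists_monopole [DecidableEq V] {μ : V → ℝ} (hμ : ∀ x, 0 < μ x)
    (c : G.toSimpleGraph.ConnectedComponent) (hc : ¬ (G.component c).Recurrent) :
    ∃ v₀ ∈ c.supp, ∃ u, G.IsMonopole μ v₀ u := by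
  classical
  obtain ⟨o, ho, f, hf, hL⟩ :=
    (G.component c).exists_finite_energy_dipole (G.component_preconnected c) hc
  set a : ℝ := μ o / (G.component c).deg o with ha
  set w : V → ℝ := fun x => if h : x ∈ c.supp then a * f ⟨x, h⟩ else 0 with hw
  have hwc : ∀ x : c.supp, w x = a * f x := fun x => dif_pos x.2
  have hwn : ∀ x, x ∉ c.supp → w x = 0 := fun x hx => dif_neg hx
  have hsum : ∀ x, HasSum (fun z => G.b x z * (w x - w z)) (if x = o then μ x else 0) := by
    intro x
    by_cases hx : x ∈ c.supp
    · have h1 := (hL ⟨x, hx⟩).mul_left a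
      have h2 : (fun z : c.supp => a * ((G.component c).b ⟨x, hx⟩ z * (f ⟨x, hx⟩ - f z))) =
          (fun z => G.b x z * (w x - w z)) ∘ Subtype.val := by
        ext z
        simp only [Function.comp_apply]
        rw [hwc z, hwc ⟨x, hx⟩]
        change a * (G.b x z * _) = _
        ring
      have h3 : a * ({o} : Set c.supp).indicator (G.component c).deg ⟨x, hx⟩ =
          if x = o then μ x else 0 := by
        by_cases hxo : x = o
        · have : (⟨x, hx⟩ : c.supp) = o := Subtype.ext hxo
          rw [if_pos hxo, this, Set.indicator_of_mem (Set.mem_singleton o), ha,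
            div_mul_cancel₀ _ ho.ne', hxo]
        · have : (⟨x, hx⟩ : c.supp) ∉ ({o} : Set c.supp) := fun h => hxo (congrArg Subtype.val h)
          rw [if_neg hxo, Set.indicator_of_notMem this, mul_zero]
      rw [h2, h3] at h1
      refine (Subtype.val_injective.hasSum_iff fun z hz => ?_).1 h1
      rw [G.b_eq_zero_of_notMem_supp c hx fun h => hz ⟨⟨z, h⟩, rfl⟩, zero_mul]
    · have h1 : ∀ z, G.b x z * (w x - w z) = 0 := by
        intro z
        by_cases hz : z ∈ c.supp
        · rw [G.symm, G.b_eq_zero_of_notMem_supp c hz hx, zero_mul]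
        · rw [hwn x hx, hwn z hz, sub_self, mul_zero]
      have hxo : x ≠ o := by
        rintro rfl
        exact hx o.2
      rw [if_neg hxo]
      simp only [h1]
      exact hasSum_zero
  refine ⟨o, o.2, fun x => (w x : ℂ), ?_, ?_⟩
  · change Summable _
    have hinj : Function.Injective (Prod.map (Subtype.val : c.supp → V) (Subtype.val : c.supp → V)) :=
      Subtype.val_injective.prodMap Subtype.val_injective
    refine (hinj.summable_iff ?_).1 ?_
    · rintro ⟨x, z⟩ hp
      by_cases hx : x ∈ c.supp
      · have hz : z ∉ c.supp := fun hz => hp ⟨(⟨x, hx⟩, ⟨z, hz⟩), rfl⟩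
        simp only [G.b_eq_zero_of_notMem_supp c hx hz, zero_mul]
      · by_cases hz : z ∈ c.supp
        · simp only [G.symm x z, G.b_eq_zero_of_notMem_supp c hz hx, zero_mul]
        · simp only [hwn x hx, hwn z hz, sub_self, norm_zero]
          ring
    · refine (hf.mul_left (a ^ 2)).congr fun p => ?_
      simp only [Function.comp_apply, Prod.map_fst, Prod.map_snd]
      rw [hwc, hwc, ← Complex.ofReal_sub, Complex.norm_real, Real.norm_eq_abs, sq_abs]
      change _ * (G.b p.1 p.2 * _) = _
      ring
  · ext x
    have h1 := Complex.hasSum_ofReal.2 (hsum x)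
    have h2 : ∑' z, (G.b x z : ℂ) * ((w x : ℂ) - w z) = ((if x = o then μ x else 0 : ℝ) : ℂ) := by
      rw [← h1.tsum_eq]
      exact tsum_congr fun z => by push_cast; rfl
    rw [laplacian, h2]
    by_cases hx : x = o
    · rw [if_pos hx, hx, Pi.single_eq_same]
      exact one_div_mul_cancel (Complex.ofReal_ne_zero.2 (hμ o).ne')
    · rw [if_neg hx, Pi.single_eq_of_ne hx, Complex.ofReal_zero, mul_zero]

theorem tsum_divergence_eq_zero_of_components
    (hrec : ∀ c : G.toSimpleGraph.ConnectedComponent, (G.component c).Recurrent) {φ : V → V → ℂ}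
    (hφ : ∀ x z, φ z x = -φ x z) (hE : Summable fun p : V × V => G.b p.1 p.2 * ‖φ p.1 p.2‖ ^ 2)
    (hdiv : Summable fun x => ‖∑' z, (G.b x z : ℂ) * φ x z‖) :
    ∑' x, ∑' z, (G.b x z : ℂ) * φ x z = 0 := by
  set D : V → ℂ := fun x => ∑' z, (G.b x z : ℂ) * φ x z with hD
  have hcomp : ∀ c : G.toSimpleGraph.ConnectedComponent, ∑' x : c.supp, D x = 0 := by
    intro c
    obtain ⟨o, ho⟩ := c.nonempty_supp
    obtain ⟨e, he⟩ := (G.component c).exists_isNullSequence (G.component_preconnected c) (hrec c)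
      ⟨o, ho⟩
    have hDc : ∀ x : c.supp, ∑' z : c.supp, ((G.component c).b x z : ℂ) * φ x z = D x := by
      intro x
      have : Function.support (fun z => (G.b x z : ℂ) * φ x z) ⊆ c.supp := by
        intro z hz
        by_contra h
        refine hz ?_
        simp only [G.b_eq_zero_of_notMem_supp c x.2 h, Complex.ofReal_zero, zero_mul]
      exact tsum_subtype_eq_of_support_subset this
    have h1 := (G.component c).tsum_divergence_eq_zero he (φ := fun x z => φ x z)
      (fun x z => hφ x z)
      (hE.comp_injective (Subtype.val_injective.prodMap Subtype.val_injective))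
      (by
        simp only [hDc]
        exact hdiv.comp_injective Subtype.val_injective)
    simp only [hDc] at h1
    exact h1
  have hDs : Summable D := hdiv.of_norm
  set F := Equiv.sigmaFiberEquiv G.toSimpleGraph.connectedComponentMk with hF
  have hDF : Summable fun p => D (F p) := F.summable_iff.2 hDs
  rw [← F.tsum_eq D, hDF.tsum_sigma]
  rw [← tsum_zero (α := ℂ) (β := G.toSimpleGraph.ConnectedComponent)]
  refine tsum_congr fun c => ?_
  rw [← hcomp c]
  exact (Equiv.subtypeEquivRight fun x => Iff.rfl :
    {x // G.toSimpleGraph.connectedComponentMk x = c} ≃ c.supp).tsum_eq fun x => D x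

end WGraph

/-! ### Transfer of summability, faces of finite sets, and simplices. -/

/-- A section of `q` over the support of `f` is injective, so it does not matter how often `q`
repeats a value. -/
theorem summable_of_summable_comp_of_support_subset_range {α β : Type*} {f : β → ℝ} {q : α → β}
    (hs : ∀ b, f b ≠ 0 → b ∈ Set.range q) (h : Summable (f ∘ q)) : Summable f := by
  choose s hs using fun b : Function.support f => hs b.1 b.2
  have hinj : Function.Injective s := fun a b hab =>
    Subtype.ext (by rw [← hs a, ← hs b, hab])
  have h1 := h.comp_injective hinj
  refine (Subtype.val_injective (p := (· ∈ Function.support f)).summable_iff fun b hb => ?_).1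
    (h1.congr fun b => ?_)
  · by_contra h0
    exact hb ⟨⟨b, h0⟩, rfl⟩
  · simp only [Function.comp_apply, hs]

theorem IsFace.exists_insert {X : Type*} [DecidableEq X] {τ σ : Finset X} (h : IsFace τ σ) :
    ∃ v, v ∉ τ ∧ insert v τ = σ := by
  have h1 : (σ \ τ).card = 1 := by
    rw [Finset.card_sdiff_of_subset h.1, h.2]; omega
  obtain ⟨v, hv⟩ := Finset.card_eq_one.1 h1
  have hv' : v ∈ σ \ τ := hv ▸ Finset.mem_singleton_self v
  refine ⟨v, (Finset.mem_sdiff.1 hv').2, ?_⟩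
  rw [Finset.insert_eq, ← hv, Finset.sdiff_union_of_subset h.1]

theorem isFace_insert {X : Type*} [DecidableEq X] {τ : Finset X} {v : X} (h : v ∉ τ) :
    IsFace τ (insert v τ) :=
  ⟨Finset.subset_insert _ _, Finset.card_insert_of_notMem h⟩

namespace WeightedComplex

variable {X : Type*} (K : WeightedComplex X)

/-- Nonemptiness matters: `∅` lies outside `Σ` when the total vertex weight is infinite. -/
theorem mem_simplices_of_subset {σ τ : Finset X} (hσ : σ ∈ K.simplices) (h : τ ⊆ σ)
    (hτ : τ.Nonempty) : τ ∈ K.simplices :=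
  ⟨K.down_closed σ hσ.1 τ h, fun h0 => absurd h0 hτ.ne_empty⟩

theorem weight_pos (σ : K.Simplex) : 0 < K.m σ.1 := K.m_pos _ σ.2.1

-- From `‖ω‖ ≤ 1 + ‖ω‖ ^ 2`, the constant being summable by local summability of the weight.
variable {K} in
theorem IsL2.mem_boundaryDomain {ω : K.Simplex → ℂ} (h : K.IsL2 ω) : ω ∈ K.boundaryDomain := by
  intro ρ
  have h1 : Summable fun τ : {τ : K.Simplex // IsFace ρ.1 τ.1} => K.m τ.1.1 * ‖ω τ.1‖ ^ 2 :=
    h.comp_injective Subtype.val_injective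
  refine Summable.of_nonneg_of_le (fun τ => mul_nonneg (K.weight_pos _).le (norm_nonneg _))
    (fun τ => ?_) ((K.locallySummable ρ).add h1)
  have h2 : ‖ω τ.1‖ ≤ 1 + ‖ω τ.1‖ ^ 2 := by nlinarith [sq_nonneg (‖ω τ.1‖ - 1)]
  have := mul_le_mul_of_nonneg_left h2 (K.weight_pos τ.1).le
  linarith

variable [DecidableEq X] {K}

/-! ### Simplices around `ρ` -/

variable {ρ : K.Simplex}

/-- The simplex `vρ`. -/
def join (v : K.link ρ) : K.Simplex := ⟨insert v.1 ρ.1, v.2.2.1⟩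

theorem isFace_join (v : K.link ρ) : IsFace ρ.1 (join v).1 := v.2.2.2

theorem mem_link_of_insert_subset {σ : K.Simplex} {v : X} (hv : v ∉ ρ.1) (h : insert v ρ.1 ⊆ σ.1) :
    v ∈ K.link ρ :=
  ⟨K.mem_simplices_of_subset σ.2
      (Finset.singleton_subset_iff.2 (h (Finset.mem_insert_self _ _))) (Finset.singleton_nonempty _),
    K.mem_simplices_of_subset σ.2 h (Finset.insert_nonempty _ _), isFace_insert hv⟩

theorem join_injective : Function.Injective (join : K.link ρ → K.Simplex) := by
  intro v w h
  have h1 : v.1 ∈ insert w.1 ρ.1 := by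
    rw [← show insert v.1 ρ.1 = insert w.1 ρ.1 from congrArg Subtype.val h]
    exact Finset.mem_insert_self _ _
  exact Subtype.ext ((Finset.mem_insert.1 h1).resolve_right (K.notMem_of_link v))

theorem exists_join_eq {τ : K.Simplex} (h : IsFace ρ.1 τ.1) : ∃ v : K.link ρ, join v = τ := by
  obtain ⟨v, hv, e⟩ := h.exists_insert
  exact ⟨⟨v, mem_link_of_insert_subset (σ := τ) hv e.subset⟩, Subtype.ext e⟩

/-- The link of `ρ` corresponds to the cofaces of `ρ`. -/
def linkEquiv (ρ : K.Simplex) : K.link ρ ≃ {τ : K.Simplex // IsFace ρ.1 τ.1} :=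
  Equiv.ofBijective (fun v => ⟨join v, isFace_join v⟩)
    ⟨fun _ _ h => join_injective (congrArg Subtype.val h), fun τ => by
      obtain ⟨v, hv⟩ := exists_join_eq τ.2
      exact ⟨v, Subtype.ext hv⟩⟩

theorem linkEquiv_apply (v : K.link ρ) : (linkEquiv ρ v).1 = join v := rfl

variable (ρ) in
/-- The oriented edges of the link. -/
abbrev LinkPair : Type _ :=
  {p : K.link ρ × K.link ρ // p.1 ≠ p.2 ∧ insert p.1.1 (insert p.2.1 ρ.1) ∈ K.simplices}

namespace LinkPair

variable (p : LinkPair ρ)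

/-- The simplex `vv'ρ`. -/
def simplex : K.Simplex := ⟨insert p.1.1.1 (insert p.1.2.1 ρ.1), p.2.2⟩

theorem edge_eq : (K.linkGraph ρ).b p.1.1 p.1.2 = K.m p.simplex.1 := if_pos p.2

theorem fst_notMem : p.1.1.1 ∉ insert p.1.2.1 ρ.1 := by
  rw [Finset.mem_insert, not_or]
  exact ⟨fun h => p.2.1 (Subtype.ext h), K.notMem_of_link _⟩

theorem isFace_snd : IsFace (join p.1.2).1 p.simplex.1 := isFace_insert p.fst_notMem

/-- The reversed edge. -/
def swap : LinkPair ρ := ⟨p.1.swap, p.2.1.symm, by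
  rw [Prod.fst_swap, Prod.snd_swap, Finset.insert_comm]; exact p.2.2⟩

theorem simplex_swap : p.swap.simplex = p.simplex := Subtype.ext (Finset.insert_comm _ _ _)

theorem isFace_fst : IsFace (join p.1.1).1 p.simplex.1 := by
  rw [← simplex_swap]; exact p.swap.isFace_snd

theorem card_simplex : p.simplex.1.card = ρ.1.card + 2 := by
  rw [p.isFace_fst.2, (isFace_join _).2]

theorem subset_simplex : ρ.1 ⊆ p.simplex.1 := (isFace_join _).1.trans p.isFace_fst.1

theorem eq_join_of_isFace {τ : K.Simplex} (h : IsFace ρ.1 τ.1) (hτ : IsFace τ.1 p.simplex.1) :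
    τ = join p.1.1 ∨ τ = join p.1.2 := by
  obtain ⟨w, rfl⟩ := exists_join_eq h
  have h1 : w.1 ∈ insert p.1.1.1 (insert p.1.2.1 ρ.1) := hτ.1 (Finset.mem_insert_self _ _)
  rw [Finset.mem_insert, Finset.mem_insert] at h1
  rcases h1 with h1 | h1 | h1
  · exact Or.inl (congrArg join (Subtype.ext h1))
  · exact Or.inr (congrArg join (Subtype.ext h1))
  · exact absurd h1 (K.notMem_of_link w)

/-- Only two faces of `vv'ρ` contain `ρ`, namely `vρ` and `v'ρ`. -/
theorem finsum_faces {F : K.Simplex → ℂ} (hF : ∀ τ, ¬ IsFace ρ.1 τ.1 → F τ = 0) :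
    ∑ᶠ τ : {τ : K.Simplex // IsFace τ.1 p.simplex.1}, F τ.1 = F (join p.1.1) + F (join p.1.2) := by
  classical
  set a : {τ : K.Simplex // IsFace τ.1 p.simplex.1} := ⟨join p.1.1, p.isFace_fst⟩
  set b : {τ : K.Simplex // IsFace τ.1 p.simplex.1} := ⟨join p.1.2, p.isFace_snd⟩
  have hab : a ≠ b := fun h => p.2.1 (join_injective (congrArg Subtype.val h))
  rw [finsum_eq_finsetSum_of_support_subset (s := {a, b}), Finset.sum_pair hab]
  intro τ hτ
  have h1 : IsFace ρ.1 τ.1.1 := by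
    by_contra h
    exact hτ (hF _ h)
  rw [Finset.coe_insert, Finset.coe_singleton]
  exact (p.eq_join_of_isFace h1 τ.2).imp Subtype.ext Subtype.ext

end LinkPair

theorem exists_linkPair {τ σ : K.Simplex} (h : IsFace ρ.1 τ.1) (hτ : IsFace τ.1 σ.1) :
    ∃ p : LinkPair ρ, p.simplex = σ ∧ join p.1.1 = τ := by
  obtain ⟨v, rfl⟩ := exists_join_eq h
  obtain ⟨w, hw, e⟩ := hτ.exists_insert
  have hw' : w ∉ insert v.1 ρ.1 := hw
  rw [Finset.mem_insert, not_or] at hw'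
  have hwl : w ∈ K.link ρ := mem_link_of_insert_subset (σ := σ) hw'.2 (by
    rw [← e]
    exact Finset.insert_subset_insert _ (Finset.subset_insert _ _))
  have e' : insert v.1 (insert w ρ.1) = σ.1 := by rw [Finset.insert_comm]; exact e
  refine ⟨⟨(v, ⟨w, hwl⟩), fun h0 => hw'.1 (congrArg Subtype.val h0).symm, ?_⟩, Subtype.ext e', rfl⟩
  change insert v.1 (insert w ρ.1) ∈ K.simplices
  rw [e']
  exact σ.2

/-- A function on oriented edges, extended by zero. -/
def extendPair (F : LinkPair ρ → ℂ) (v w : K.link ρ) : ℂ :=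
  open Classical in
  if h : v ≠ w ∧ insert v.1 (insert w.1 ρ.1) ∈ K.simplices then F ⟨(v, w), h⟩ else 0

theorem extendPair_apply (F : LinkPair ρ → ℂ) (p : LinkPair ρ) :
    extendPair F p.1.1 p.1.2 = F p := dif_pos p.2

theorem extendPair_of_not (F : LinkPair ρ → ℂ) {v w : K.link ρ}
    (h : ¬ (v ≠ w ∧ insert v.1 (insert w.1 ρ.1) ∈ K.simplices)) : extendPair F v w = 0 :=
  dif_neg h

theorem linkEdge_of_not {v w : K.link ρ}
    (h : ¬ (v ≠ w ∧ insert v.1 (insert w.1 ρ.1) ∈ K.simplices)) : (K.linkGraph ρ).b v w = 0 :=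
  if_neg h

/-- Summation over the cofaces of `vρ`. -/
theorem tsum_coface_join (v : K.link ρ) (F : K.Simplex → ℂ) :
    ∑' σ : {σ : K.Simplex // IsFace (join v).1 σ.1}, (K.m σ.1.1 : ℂ) * F σ.1 =
      ∑' w, ((K.linkGraph ρ).b v w : ℂ) * extendPair (fun p => F p.simplex) v w := by
  have hbij : Function.Bijective (K.linkCoface ρ v) := by
    refine ⟨K.linkCoface_injective ρ v, fun σ => ?_⟩
    obtain ⟨p, hp, hv⟩ := exists_linkPair (isFace_join v) (σ := σ.1) σ.2
    obtain rfl := join_injective hv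
    exact ⟨⟨p.1.2, p.2⟩, Subtype.ext hp⟩
  have h1 := (Equiv.ofBijective _ hbij).tsum_eq
    (fun σ : {σ : K.Simplex // IsFace (join v).1 σ.1} => (K.m σ.1.1 : ℂ) * F σ.1)
  have h2 : Function.support (fun w => ((K.linkGraph ρ).b v w : ℂ) *
      extendPair (fun p => F p.simplex) v w) ⊆
      {w | v ≠ w ∧ insert v.1 (insert w.1 ρ.1) ∈ K.simplices} := by
    intro w hw
    by_contra h
    refine hw ?_
    simp only [extendPair_of_not _ h, mul_zero]
  rw [← tsum_subtype_eq_of_support_subset h2]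
  refine h1.symm.trans (tsum_congr fun w => ?_)
  set p : LinkPair ρ := ⟨(v, w.1), w.2⟩ with hp
  have e1 := extendPair_apply (fun p : LinkPair ρ => F p.simplex) p
  have e2 := p.edge_eq
  change extendPair _ v w.1 = _ at e1
  change (K.linkGraph ρ).b v w.1 = _ at e2
  rw [e1, e2]
  rfl

theorem summable_linkGraph_iff {f : K.link ρ × K.link ρ → ℝ} :
    (Summable fun p : K.link ρ × K.link ρ => (K.linkGraph ρ).b p.1 p.2 * f p) ↔
      Summable fun p : LinkPair ρ => K.m p.simplex.1 * f p.1 := by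
  rw [← Subtype.val_injective (p := fun p : K.link ρ × K.link ρ => p.1 ≠ p.2 ∧
    insert p.1.1 (insert p.2.1 ρ.1) ∈ K.simplices).summable_iff]
  · refine summable_congr fun p => ?_
    rw [← LinkPair.edge_eq p]
    rfl
  · intro p hp
    rw [linkEdge_of_not fun h => hp ⟨⟨p, h⟩, rfl⟩, zero_mul]

end WeightedComplex

/-- The pair `(q a, r a)` determines `a`, and `r a` has at most `N` possible values once `q a` is
fixed. -/
theorem summable_comp_of_finite_fibers {α β X : Type*} {f : β → ℝ} (hf : Summable f)
    (hf0 : ∀ b, 0 ≤ f b) (s : β → Finset X) {N : ℕ} (hs : ∀ b, (s b).card = N) {q : α → β}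
    {r : α → X} (hr : ∀ a, r a ∈ s (q a)) (hinj : ∀ a a', q a = q a' → r a = r a' → a = a') :
    Summable fun a => f (q a) := by
  have h2 : Summable fun t : (b : β) × s b => f t.1 := by
    have h0 : 0 ≤ fun t : (b : β) × s b => f t.1 := fun t => hf0 t.1
    rw [summable_sigma_of_nonneg h0]
    refine ⟨fun b => Summable.of_finite, (hf.mul_left (N : ℝ)).congr fun b => ?_⟩
    change _ = ∑' _ : s b, f b
    rw [tsum_fintype, Finset.sum_const, Finset.card_univ, Fintype.card_coe, hs b, nsmul_eq_mul]
  have h3 : Function.Injective fun a => (⟨q a, ⟨r a, hr a⟩⟩ : (b : β) × s b) := by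
    intro a a' h
    refine hinj a a' (congrArg Sigma.fst h) ?_
    exact congrArg (fun t : (b : β) × s b => t.2.1) h
  exact h2.comp_injective h3

namespace WeightedComplex.Coboundary

variable {X : Type*} [DecidableEq X] {K : WeightedComplex X} (d : K.Coboundary) {ρ : K.Simplex}

/-! ### Incidence numbers -/

theorem θ_eq_zero {τ σ : K.Simplex} (h : ¬ IsFace τ.1 σ.1) : d.θ τ σ = 0 := by
  by_contra h0
  exact h ((d.entry_ne_zero_iff τ σ).1 h0)

theorem θ_mul_self {τ σ : K.Simplex} (h : IsFace τ.1 σ.1) : d.θ τ σ * d.θ τ σ = 1 := by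
  have h1 := d.entry τ σ
  have h2 := (d.entry_ne_zero_iff τ σ).2 h
  change d.θ τ σ ∈ _ at h1
  change d.θ τ σ ≠ 0 at h2
  rcases h1 with h1 | h1 | h1
  · rw [h1]; norm_num
  · rw [h1]; norm_num
  · exact absurd h1 h2

theorem norm_θ {τ σ : K.Simplex} (h : IsFace τ.1 σ.1) : ‖d.θ τ σ‖ = 1 := by
  have h1 := congrArg norm (d.θ_mul_self h)
  rw [norm_mul, norm_one] at h1
  nlinarith [norm_nonneg (d.θ τ σ)]

/-- The product `θ(ρ, vρ) θ(vρ, vv'ρ)`. -/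
def sign (p : LinkPair ρ) : ℂ := d.θ ρ (join p.1.1) * d.θ (join p.1.1) p.simplex

theorem norm_sign (p : LinkPair ρ) : ‖d.sign p‖ = 1 := by
  rw [sign, norm_mul, d.norm_θ (isFace_join _), d.norm_θ p.isFace_fst, one_mul]

theorem δ_simplex {ω : K.Simplex → ℂ} (hω : ∀ τ, ¬ IsFace ρ.1 τ.1 → ω τ = 0) (p : LinkPair ρ) :
    d.δ ω p.simplex = d.θ (join p.1.1) p.simplex * ω (join p.1.1) +
      d.θ (join p.1.2) p.simplex * ω (join p.1.2) := by
  rw [d.apply_eq]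
  exact p.finsum_faces (F := fun τ => d.θ τ p.simplex * ω τ) fun τ h => by rw [hω τ h, mul_zero]

/-- This is `δδ 1_ρ = 0` evaluated at `vv'ρ`, where the two terms are the paths through `vρ` and
`v'ρ`. -/
theorem sign_swap (p : LinkPair ρ) : d.sign p.swap = -d.sign p := by
  have h1 := congrFun (d.comp_self (Pi.single ρ 1)) p.simplex
  rw [d.δ_simplex (ρ := ρ) (ω := d.δ (Pi.single ρ 1)) fun τ h => d.θ_eq_zero h] at h1
  change d.θ (join p.1.1) p.simplex * d.θ ρ (join p.1.1) +
    d.θ (join p.1.2) p.simplex * d.θ ρ (join p.1.2) = 0 at h1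
  have h2 : d.sign p.swap = d.θ ρ (join p.1.2) * d.θ (join p.1.2) p.simplex := by
    rw [← p.simplex_swap]; rfl
  rw [h2, sign]
  linear_combination h1

theorem lift_join (u : K.link ρ → ℂ) (v : K.link ρ) :
    d.lift ρ u (join v) = u v * d.θ ρ (join v) := by
  have h : ∃ w : K.link ρ, insert w.1 ρ.1 = (join v).1 := ⟨v, rfl⟩
  have h1 : h.choose = v := join_injective (Subtype.ext h.choose_spec)
  rw [lift, dif_pos h, h1]

theorem lift_of_not_isFace (u : K.link ρ → ℂ) {τ : K.Simplex} (h : ¬ IsFace ρ.1 τ.1) :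
    d.lift ρ u τ = 0 := by
  refine dif_neg ?_
  rintro ⟨v, hv⟩
  exact h (hv ▸ isFace_join v)

theorem δ_lift (u : K.link ρ → ℂ) (p : LinkPair ρ) :
    d.δ (d.lift ρ u) p.simplex = d.sign p * (u p.1.1 - u p.1.2) := by
  rw [d.δ_simplex (ρ := ρ) fun τ h => d.lift_of_not_isFace u h, lift_join, lift_join]
  have h1 := d.sign_swap p
  have h2 : d.sign p.swap = d.θ ρ (join p.1.2) * d.θ (join p.1.2) p.simplex := by
    rw [← p.simplex_swap]; rfl
  rw [h2] at h1
  have h3 : d.sign p = d.θ ρ (join p.1.1) * d.θ (join p.1.1) p.simplex := rfl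
  linear_combination u p.1.2 * h1 - u p.1.1 * h3

theorem exists_linkPair_of_δ_lift_ne_zero {u : K.link ρ → ℂ} {σ : K.Simplex}
    (h : d.δ (d.lift ρ u) σ ≠ 0) : ∃ p : LinkPair ρ, p.simplex = σ := by
  by_contra hσ
  refine h ?_
  rw [d.apply_eq]
  refine finsum_eq_zero_of_forall_eq_zero fun τ => ?_
  by_cases hτ : IsFace ρ.1 τ.1.1
  · obtain ⟨p, hp, -⟩ := exists_linkPair hτ τ.2
    exact absurd ⟨p, hp⟩ hσ
  · rw [d.lift_of_not_isFace u hτ, mul_zero]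

/-! ### The boundary operator around `ρ` -/

theorem boundary_apply (η : K.Simplex → ℂ) (ρ : K.Simplex) :
    d.boundary η ρ =
      (1 / (K.m ρ.1 : ℂ)) * ∑' v : K.link ρ,
        (K.m (join v).1 : ℂ) * d.θ ρ (join v) * η (join v) := by
  rw [boundary, ← (linkEquiv ρ).tsum_eq]
  rfl

/-- The flow on the link of `ρ` given by `ω`. -/
def flow (ρ : K.Simplex) (ω : K.Simplex → ℂ) : K.link ρ → K.link ρ → ℂ :=
  extendPair fun p => d.sign p * ω p.simplex

theorem flow_antisymm (ω : K.Simplex → ℂ) (v w : K.link ρ) :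
    d.flow ρ ω w v = -d.flow ρ ω v w := by
  by_cases h : v ≠ w ∧ insert v.1 (insert w.1 ρ.1) ∈ K.simplices
  · set p : LinkPair ρ := ⟨(v, w), h⟩
    have h1 := extendPair_apply (fun p => d.sign p * ω p.simplex) p
    have h2 := extendPair_apply (fun p => d.sign p * ω p.simplex) p.swap
    rw [sign_swap, p.simplex_swap, neg_mul, ← h1] at h2
    exact h2
  · have h' : ¬ (w ≠ v ∧ insert w.1 (insert v.1 ρ.1) ∈ K.simplices) := by
      rwa [Finset.insert_comm, ne_comm]
    rw [flow, extendPair_of_not _ h, extendPair_of_not _ h', neg_zero]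

theorem divergence_flow (ω : K.Simplex → ℂ) (v : K.link ρ) :
    ∑' w, ((K.linkGraph ρ).b v w : ℂ) * d.flow ρ ω v w =
      (K.m (join v).1 : ℂ) * d.θ ρ (join v) * d.boundary ω (join v) := by
  have hm : (K.m (join v).1 : ℂ) ≠ 0 := Complex.ofReal_ne_zero.2 (K.weight_pos (join v)).ne'
  have h1 := tsum_coface_join v fun σ => d.θ ρ (join v) * (d.θ (join v) σ * ω σ)
  have h2 : ∀ w, d.flow ρ ω v w =
      extendPair (fun p => d.θ ρ (join v) * (d.θ (join v) p.simplex * ω p.simplex)) v w := by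
    intro w
    by_cases h : v ≠ w ∧ insert v.1 (insert w.1 ρ.1) ∈ K.simplices
    · set p : LinkPair ρ := ⟨(v, w), h⟩
      refine (extendPair_apply (fun p => d.sign p * ω p.simplex) p).trans
        (Eq.trans ?_ (extendPair_apply
          (fun p => d.θ ρ (join v) * (d.θ (join v) p.simplex * ω p.simplex)) p).symm)
      exact mul_assoc _ _ _
    · rw [flow, extendPair_of_not _ h, extendPair_of_not _ h]
  simp only [h2]
  rw [← h1, boundary]
  have h3 : ∀ σ : {σ : K.Simplex // IsFace (join v).1 σ.1},
      (K.m σ.1.1 : ℂ) * (d.θ ρ (join v) * (d.θ (join v) σ.1 * ω σ.1)) =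
        d.θ ρ (join v) * ((K.m σ.1.1 : ℂ) * d.θ (join v) σ.1 * ω σ.1) := fun σ => by ring
  simp only [h3, tsum_mul_left]
  field_simp

/-- An oriented edge is determined by its simplex and first vertex, so each simplex of cardinality
`ρ.1.card + 2` is counted a bounded number of times. -/
theorem summable_energy_flow {ω : K.Simplex → ℂ} (hω : K.IsL2 ω) :
    Summable fun p : K.link ρ × K.link ρ => (K.linkGraph ρ).b p.1 p.2 * ‖d.flow ρ ω p.1 p.2‖ ^ 2 := by
  rw [summable_linkGraph_iff (f := fun p => ‖d.flow ρ ω p.1 p.2‖ ^ 2)]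
  have h1 : ∀ p : LinkPair ρ, ‖d.flow ρ ω p.1.1 p.1.2‖ ^ 2 = ‖ω p.simplex‖ ^ 2 := by
    intro p
    rw [flow, extendPair_apply, norm_mul, norm_sign, one_mul]
  simp only [h1]
  have h3 : Summable fun σ : {σ : K.Simplex // σ.1.card = ρ.1.card + 2} =>
      K.m σ.1.1 * ‖ω σ.1‖ ^ 2 := hω.comp_injective Subtype.val_injective
  refine summable_comp_of_finite_fibers h3 (fun σ => mul_nonneg (K.weight_pos _).le (sq_nonneg _))
    (fun σ => σ.1.1) (fun σ => σ.2) (q := fun p : LinkPair ρ => ⟨p.simplex, p.card_simplex⟩)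
    (r := fun p => p.1.1.1) (fun p => Finset.mem_insert_self _ _) ?_
  · intro p p' h h'
    have e1 : p.simplex = p'.simplex := congrArg Subtype.val h
    have e2 : p.1.1 = p'.1.1 := Subtype.ext h'
    have e3 : p.1.2 = p'.1.2 := by
      have h4 : p.1.2.1 ∈ p'.simplex.1 := by
        rw [← e1]
        exact Finset.mem_insert_of_mem (Finset.mem_insert_self _ _)
      have h5 : p.1.2.1 ∈ insert p'.1.1.1 (insert p'.1.2.1 ρ.1) := h4
      rw [Finset.mem_insert, Finset.mem_insert] at h5
      rcases h5 with h5 | h5 | h5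
      · exact absurd (e2.trans (Subtype.ext h5.symm)) p.2.1
      · exact Subtype.ext h5
      · exact absurd h5 (K.notMem_of_link _)
    exact Subtype.ext (Prod.ext e2 e3)

/-- The condition `d.boundary ω ∈ K.boundaryDomain` at `ρ` is precisely absolute summability of the
divergence of the flow. -/
theorem boundary_boundary_eq_zero {ω : K.Simplex → ℂ} (hω : K.IsL2 ω)
    (hω' : d.boundary ω ∈ K.boundaryDomain) (hρ : K.LinkRecurrent ρ) :
    d.boundary (d.boundary ω) ρ = 0 := by
  have h1 := (K.linkGraph ρ).tsum_divergence_eq_zero_of_components hρ (d.flow_antisymm ω)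
    (d.summable_energy_flow hω) (by
      simp only [divergence_flow]
      refine ((linkEquiv ρ).summable_iff.2 (hω' ρ)).congr fun v => ?_
      simp only [Function.comp_apply, linkEquiv_apply]
      rw [norm_mul, norm_mul, d.norm_θ (isFace_join v), mul_one, Complex.norm_real,
        Real.norm_of_nonneg (K.weight_pos _).le])
  simp only [divergence_flow] at h1
  rw [boundary_apply, h1, mul_zero]

/-! ### The cochain given by a monopole -/

variable {u : K.link ρ → ℂ}

theorem isL2_δ_lift (hu : u ∈ (K.linkGraph ρ).finiteEnergy) : K.IsL2 (d.δ (d.lift ρ u)) := by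
  refine summable_of_summable_comp_of_support_subset_range (q := fun p : LinkPair ρ => p.simplex)
    (fun σ hσ => ?_) ?_
  · refine d.exists_linkPair_of_δ_lift_ne_zero (u := u) fun h => hσ ?_
    rw [h, norm_zero]
    ring
  · refine ((summable_linkGraph_iff (f := fun p => ‖u p.1 - u p.2‖ ^ 2)).1 hu).congr fun p => ?_
    rw [Function.comp_apply, δ_lift, norm_mul, norm_sign, one_mul]

theorem boundary_δ_lift_join (v : K.link ρ) :
    d.boundary (d.δ (d.lift ρ u)) (join v) =
      d.θ ρ (join v) * (K.linkGraph ρ).laplacian (K.linkWeight ρ) u v := by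
  have hm : (K.m (join v).1 : ℂ) ≠ 0 := Complex.ofReal_ne_zero.2 (K.weight_pos (join v)).ne'
  have h1 := d.divergence_flow (d.δ (d.lift ρ u)) v
  have h2 : ∀ w, ((K.linkGraph ρ).b v w : ℂ) * d.flow ρ (d.δ (d.lift ρ u)) v w =
      ((K.linkGraph ρ).b v w : ℂ) * (u v - u w) := by
    intro w
    by_cases h : v ≠ w ∧ insert v.1 (insert w.1 ρ.1) ∈ K.simplices
    · set p : LinkPair ρ := ⟨(v, w), h⟩
      congr 1
      refine (extendPair_apply (fun p => d.sign p * d.δ (d.lift ρ u) p.simplex) p).trans ?_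
      have h3 : d.sign p * d.sign p = 1 := by
        have e1 := d.θ_mul_self (isFace_join p.1.1)
        have e2 := d.θ_mul_self p.isFace_fst
        rw [sign]
        linear_combination d.θ (join p.1.1) p.simplex * d.θ (join p.1.1) p.simplex * e1 + e2
      rw [δ_lift]
      linear_combination (u v - u w) * h3
    · rw [linkEdge_of_not h]
      simp
  simp only [h2] at h1
  have h3 : (K.linkGraph ρ).laplacian (K.linkWeight ρ) u v =
      (1 / (K.m (join v).1 : ℂ)) * ∑' w, ((K.linkGraph ρ).b v w : ℂ) * (u v - u w) := rfl
  rw [h3, h1]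
  have h4 := d.θ_mul_self (isFace_join v)
  rw [← mul_assoc, ← mul_assoc, ← mul_assoc]
  have h5 : d.θ ρ (join v) * (1 / (K.m (join v).1 : ℂ)) * (K.m (join v).1 : ℂ) *
      d.θ ρ (join v) = 1 := by
    rw [mul_assoc (d.θ ρ (join v)), one_div_mul_cancel hm, mul_one, h4]
  rw [h5, one_mul]

theorem boundary_boundary_δ_lift {v₀ : K.link ρ}
    (hu : (K.linkGraph ρ).IsMonopole (K.linkWeight ρ) v₀ u) :
    d.boundary (d.boundary (d.δ (d.lift ρ u))) ρ ≠ 0 := by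
  rw [boundary_apply]
  simp only [boundary_δ_lift_join, hu.2]
  rw [tsum_eq_single v₀]
  · rw [Pi.single_eq_same, mul_one, mul_assoc, d.θ_mul_self (isFace_join v₀), mul_one]
    exact mul_ne_zero (one_div_ne_zero (Complex.ofReal_ne_zero.2 (K.weight_pos ρ).ne'))
      (Complex.ofReal_ne_zero.2 (K.weight_pos (join v₀)).ne')
  · intro v hv
    rw [Pi.single_eq_of_ne hv, mul_zero, mul_zero]

/-- The faces `vv'ρ \ w` with `w ∈ ρ`. -/
def eraseSimplex (x : LinkPair ρ × ρ.1) : K.Simplex :=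
  ⟨x.1.simplex.1.erase x.2.1, K.mem_simplices_of_subset x.1.simplex.2 (Finset.erase_subset _ _)
    ⟨x.1.1.1.1, Finset.mem_erase.2 ⟨fun h => K.notMem_of_link x.1.1.1 (h ▸ x.2.2),
      Finset.mem_insert_self _ _⟩⟩⟩

theorem isFace_eraseSimplex (x : LinkPair ρ × ρ.1) : IsFace (eraseSimplex x).1 x.1.simplex.1 :=
  ⟨Finset.erase_subset _ _,
    (Finset.card_erase_add_one (x.1.subset_simplex x.2.2)).symm⟩

/-- Here `τ` has one element more than `ρ` but does not contain it, so `τ ∪ ρ` is strictly larger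
than `τ` and fills `vv'ρ`. Thus `τ` determines its only coface that comes from the link of `ρ`. -/
theorem simplex_eq_union {τ : K.Simplex} (hτ : ¬ IsFace ρ.1 τ.1) {p : LinkPair ρ}
    (h : IsFace τ.1 p.simplex.1) : τ.1 ∪ ρ.1 = p.simplex.1 := by
  have hsub : τ.1 ∪ ρ.1 ⊆ p.simplex.1 := Finset.union_subset h.1 p.subset_simplex
  refine Finset.eq_of_subset_of_card_le hsub ?_
  have h1 : τ.1 ⊂ τ.1 ∪ ρ.1 := by
    refine Finset.ssubset_iff_subset_ne.2 ⟨Finset.subset_union_left, fun h0 => hτ ⟨?_, ?_⟩⟩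
    · rw [h0]; exact Finset.subset_union_right
    · have := h.2
      rw [p.card_simplex] at this
      omega
  have h2 := Finset.card_lt_card h1
  rw [h.2]
  omega

theorem boundary_δ_lift_of_not_isFace {τ : K.Simplex} (hτ : ¬ IsFace ρ.1 τ.1) {p : LinkPair ρ}
    (h : IsFace τ.1 p.simplex.1) :
    d.boundary (d.δ (d.lift ρ u)) τ = (1 / (K.m τ.1 : ℂ)) *
      ((K.m p.simplex.1 : ℂ) * d.θ τ p.simplex * d.δ (d.lift ρ u) p.simplex) := by
  rw [boundary, tsum_eq_single ⟨p.simplex, h⟩]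
  intro σ hσ
  by_cases h0 : d.δ (d.lift ρ u) σ.1 = 0
  · rw [h0, mul_zero]
  · obtain ⟨p', hp'⟩ := d.exists_linkPair_of_δ_lift_ne_zero h0
    have h2 := σ.2
    rw [← hp'] at h2
    exact absurd (Subtype.ext (hp'.symm.trans (Subtype.ext
      ((simplex_eq_union hτ h2).symm.trans (simplex_eq_union hτ h))))) hσ

theorem exists_eraseSimplex {τ : K.Simplex} (hτ : ¬ IsFace ρ.1 τ.1)
    (h : d.boundary (d.δ (d.lift ρ u)) τ ≠ 0) : ∃ x : LinkPair ρ × ρ.1, eraseSimplex x = τ := by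
  obtain ⟨σ, hσ⟩ : ∃ σ : {σ : K.Simplex // IsFace τ.1 σ.1}, d.δ (d.lift ρ u) σ.1 ≠ 0 := by
    by_contra! h0
    refine h ?_
    rw [boundary]
    simp only [h0, mul_zero, tsum_zero]
  obtain ⟨p, hp⟩ := d.exists_linkPair_of_δ_lift_ne_zero hσ
  have h2 := σ.2
  rw [← hp] at h2
  obtain ⟨w, hw, e⟩ := h2.exists_insert
  have hwρ : w ∈ ρ.1 := by
    have h3 : w ∈ τ.1 ∪ ρ.1 := by
      rw [simplex_eq_union hτ h2, ← e]
      exact Finset.mem_insert_self _ _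
    exact (Finset.mem_union.1 h3).resolve_left hw
  refine ⟨(p, ⟨w, hwρ⟩), Subtype.ext ?_⟩
  change p.simplex.1.erase w = τ.1
  rw [← e, Finset.erase_insert hw]

/-- Among the cofaces of `ρ` only `v₀ρ` contributes. At `τ = vv'ρ \ w` the summand is `m(vv'ρ)² /
m(τ) · ‖u v - u v'‖²`, at most `C` times the energy of the edge, and `ρ` offers finitely many `w`.
-/
theorem isL2_boundary_δ_lift (hbal : K.LocallyBalanced) {v₀ : K.link ρ}
    (hu : (K.linkGraph ρ).IsMonopole (K.linkWeight ρ) v₀ u) :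
    K.IsL2 (d.boundary (d.δ (d.lift ρ u))) := by
  classical
  set η := d.boundary (d.δ (d.lift ρ u)) with hη
  set f : K.Simplex → ℝ := fun τ => K.m τ.1 * ‖η τ‖ ^ 2 with hf
  have hf0 : ∀ τ, 0 ≤ f τ := fun τ => mul_nonneg (K.weight_pos τ).le (sq_nonneg _)
  have h1 : Summable fun τ => if IsFace ρ.1 τ.1 then f τ else 0 := by
    refine summable_of_ne_finset_zero (s := {join v₀}) fun τ hτ => ?_
    split_ifs with h
    · obtain ⟨v, rfl⟩ := exists_join_eq h
      have hv : v ≠ v₀ := fun h => hτ (by rw [h]; exact Finset.mem_singleton_self _)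
      rw [hf]
      simp only [hη, boundary_δ_lift_join, hu.2, Pi.single_eq_of_ne hv, mul_zero, norm_zero]
      ring
    · rfl
  have h2 : Summable fun τ => if IsFace ρ.1 τ.1 then 0 else f τ := by
    refine summable_of_summable_comp_of_support_subset_range (q := eraseSimplex (ρ := ρ))
      (fun τ hτ => ?_) ?_
    · split_ifs at hτ with h
      · exact absurd rfl hτ
      · refine d.exists_eraseSimplex (u := u) h fun h0 => hτ ?_
        rw [hf]
        simp only [hη, h0, norm_zero]
        ring
    · obtain ⟨C, hC⟩ := hbal ρ
      have hs := (summable_linkGraph_iff (f := fun p => ‖u p.1 - u p.2‖ ^ 2)).1 hu.1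
      have hs2 : Summable fun x : LinkPair ρ × ρ.1 =>
          (C * (K.m x.1.simplex.1 * ‖u x.1.1.1 - u x.1.1.2‖ ^ 2)) := by
        have h3 := hs.mul_of_nonneg (g := fun _ : ρ.1 => (1 : ℝ)) Summable.of_finite
          (fun p => mul_nonneg (K.weight_pos _).le (sq_nonneg _)) fun _ => zero_le_one
        exact (h3.mul_left C).congr fun x => by rw [mul_one]
      refine Summable.of_nonneg_of_le (fun x => ?_) (fun x => ?_) hs2
      · rw [Function.comp_apply]
        split_ifs
        · exact le_rfl
        · exact hf0 _
      · have hCx : K.m x.1.simplex.1 / K.m (eraseSimplex x).1 ≤ C :=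
          hC x.1.1.1 x.1.1.2 x.1.2.1 x.1.2.2 x.2.1 x.2.2
        have hmσ := K.weight_pos x.1.simplex
        have hmτ := K.weight_pos (eraseSimplex x)
        -- The sign of `C` is known only once some `x` exists, so it is derived inside the termwise
        -- estimate.
        have hC0 : 0 ≤ C := (div_nonneg hmσ.le hmτ.le).trans hCx
        have hn : 0 ≤ K.m x.1.simplex.1 * ‖u x.1.1.1 - u x.1.1.2‖ ^ 2 :=
          mul_nonneg hmσ.le (sq_nonneg _)
        rw [Function.comp_apply]
        split_ifs with h
        · exact mul_nonneg hC0 hn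
        · refine le_trans (le_of_eq ?_) (mul_le_mul_of_nonneg_right hCx hn)
          rw [hf]
          simp only [hη]
          rw [d.boundary_δ_lift_of_not_isFace h (isFace_eraseSimplex x), δ_lift, norm_mul, norm_mul,
            norm_mul, norm_mul, norm_sign, d.norm_θ (isFace_eraseSimplex x), norm_div, norm_one,
            Complex.norm_real, Complex.norm_real, Real.norm_of_nonneg hmσ.le,
            Real.norm_of_nonneg hmτ.le]
          field_simp
  refine (h1.add h2).congr fun τ => ?_
  change _ = f τ
  split_ifs
  · exact add_zero _
  · exact zero_add _

end WeightedComplex.Coboundary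

end

/-! ### Assembly of the three statements. -/

theorem mainTheorem2 {X : Type*} [DecidableEq X] (K : WeightedComplex X) (d : K.Coboundary)
    (hbal : K.LocallyBalanced) :
    (d.NeumannComplexProperty ↔ ∀ ρ : K.Simplex, K.LinkRecurrent ρ) ∧
    (∀ (ρ : K.Simplex) (c : (K.linkGraph ρ).toSimpleGraph.ConnectedComponent),
      ¬ ((K.linkGraph ρ).component c).Recurrent →
        ∃ v₀ ∈ c.supp, ∃ u, (K.linkGraph ρ).IsMonopole (K.linkWeight ρ) v₀ u) ∧
    (∀ (ρ : K.Simplex) (v₀ : K.link ρ) (u : K.link ρ → ℂ),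
      (K.linkGraph ρ).IsMonopole (K.linkWeight ρ) v₀ u →
        K.IsL2 (d.δ (d.lift ρ u)) ∧
        d.δ (d.lift ρ u) ∈ K.boundaryDomain ∧
        K.IsL2 (d.boundary (d.δ (d.lift ρ u))) ∧
        d.boundary (d.δ (d.lift ρ u)) ∈ K.boundaryDomain ∧
        d.boundary (d.boundary (d.δ (d.lift ρ u))) ρ ≠ 0) := by
  refine ⟨⟨fun h ρ c => ?_, fun h ω hω hω' => ?_⟩, fun ρ c hc => ?_, fun ρ v₀ u hu => ?_⟩
  · by_contra hc
    obtain ⟨v₀, -, u, hu⟩ := (K.linkGraph ρ).exists_monopole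
      (μ := K.linkWeight ρ) (fun v => K.weight_pos (WeightedComplex.join v)) c hc
    have h1 := d.isL2_δ_lift hu.1
    have h2 := d.isL2_boundary_δ_lift hbal hu
    exact d.boundary_boundary_δ_lift hu
      (congrFun (h _ ⟨h1, h1.mem_boundaryDomain, h2⟩ h2.mem_boundaryDomain) ρ)
  · ext ρ
    exact d.boundary_boundary_eq_zero hω.1 hω' (h ρ)
  · exact (K.linkGraph ρ).exists_monopole (fun v => K.weight_pos (WeightedComplex.join v)) c hc
  · have h1 := d.isL2_δ_lift hu.1
    have h2 := d.isL2_boundary_δ_lift hbal hu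
    exact ⟨h1, h1.mem_boundaryDomain, h2, h2.mem_boundaryDomain, d.boundary_boundary_δ_lift hu⟩
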